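/- Let $\alpha>0$ and let $d\ge1$ be an integer with $d>\alpha\wedge 2$. For $L\ge 1$ write $|||x|||_L=\frac{\pi}{2}\max\{|x|,L\}$, where $|x|$ is the Euclidean norm of $x\in\mathbb R^d$. Let $K_{\rm lb}>0$, $K_{\rm ub}\ge 1$ and $\Delta\in(0,1)$. Then there is a constant $K_C>0$, depending only on $d$, $\alpha$, $K_{\rm lb}$, $K_{\rm ub}$ and $\Delta$ (so only on $K_{\rm ub}$ and $\Delta$, for given $d$ and $\alpha$, when $K_{\rm lb}=K_{\rm ub}^{-1}$), such that the following holds. Let $L\ge1$ and let $P:\mathbb Z^d\to[0,\infty)$ be a probability distribution that is $\mathbb Z^d$-symmetric (invariant under reflections in coordinate hyperplanes and rotations by $\pi/2$ in coordinate planes), with $P(0)=0$, $$\frac{\frac12 K_{\rm lb}L^{\alpha}}{|||x|||_L^{d+\alpha}}\le P(x)\le\frac{2K_{\rm ub}L^\alpha}{|||x|||_L^{d+\alpha}}\qquad(x\ne0),$$ and such that $\hat P(k)=\sum_{x\in\mathbb Z^d}P(x)e^{ik\cdot x}$ satisfies $$1-\hat P(k)<2-\tfrac12\Delta\quad(k\in(-\pi,\pi]^d),\qquad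 1-\hat P(k)>\tfrac12\Delta\quad(k\in(-\pi,\pi]^d,\ \|k\|_\infty>L^{-1}).$$ For $\mu\in[0,1]$ and $x\in\mathbb Z^d$ let $$S_\mu(x)=\sum_{\omega}\prod_{j=1}^{|\omega|}\mu P(\omega_j-\omega_{j-1})\in[0,\infty],$$ where the sum runs over all paths $\omega=(\omega_0,\dots,\omega_{|\omega|})$ in $\mathbb Z^d$ of any length $|\omega|\ge0$ with $\omega_0=0$ and $\omega_{|\omega|}=x$. Then, for all $\mu\in[0,1]$ and all $x\in\mathbb Z^d$, if $\alpha\neq2$, $$S_\mu(x)\le\delta_{0,x}+\frac{K_C}{L^{\alpha\wedge2}\,|||x|||_L^{d-\alpha\wedge2}}\left(1\wedge\frac{1}{|||\frac xL|||_1^{2(\alpha\wedge2)}(1-\mu)^2}\right),$$ and, if $\alpha=2$, $$S_\mu(x)\le\delta_{0,x}+\frac{K_C}{L^{2}\,|||x|||_L^{d-2}\log|||\frac xL|||_1}\left(1\wedge\frac{(\log|||\frac xL|||_1)^2}{|||\frac xL|||_1^{4}(1-\mu)^2}\right),$$ where at $\mu=1$ the minimum is read as $1$. -/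

import Mathlib

open scoped ENNReal

noncomputable section

namespace LongRange

/-- The inclusion of `ℤ^d` into Euclidean space `ℝ^d`. -/
def toEuclid {d : ℕ} (x : Fin d → ℤ) : EuclideanSpace ℝ (Fin d) :=
  WithLp.toLp 2 (fun i => (x i : ℝ))

/-- The regularised norm `|||x|||_L = (π / 2) * max {|x|, L}`, with `|x|` the Euclidean norm. -/
def tnorm {d : ℕ} (L : ℝ) (x : EuclideanSpace ℝ (Fin d)) : ℝ :=
  Real.pi / 2 * max ‖x‖ L

/-- `ℤ^d`-symmetry: invariance under the reflections in the coordinate hyperplanes and under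
the rotations by `π / 2` in the coordinate planes. -/
structure IsZdSymmetric {d : ℕ} (P : (Fin d → ℤ) → ℝ) : Prop where
  reflection : ∀ (i : Fin d) (x : Fin d → ℤ), P (Function.update x i (-x i)) = P x
  rotation : ∀ (i j : Fin d), i ≠ j → ∀ x : Fin d → ℤ,
    P (Function.update (Function.update x i (-x j)) j (x i)) = P x

/-- The Fourier transform `∑ x, P x * exp (i k · x)`. -/
def fourier {d : ℕ} (P : (Fin d → ℤ) → ℝ) (k : Fin d → ℝ) : ℂ :=
  ∑' x : Fin d → ℤ, (P x : ℂ) * Complex.exp (Complex.I * ((∑ i, k i * (x i : ℝ) : ℝ) : ℂ))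

/-- `P` is a `ℤ^d`-symmetric probability distribution on `ℤ^d` with `P 0 = 0` that obeys the
power-law bounds with constants `Klb`, `Kub` and the Fourier bounds with constant `Δ`, at
exponent `α` and range `L`. The Fourier transform of such a `P` is real-valued by symmetry, so
taking its real part loses nothing; `‖k‖` is the supremum norm. -/
structure IsPowerLawKernel {d : ℕ} (α L Klb Kub Δ : ℝ) (P : (Fin d → ℤ) → ℝ) : Prop where
  nonneg : ∀ x, 0 ≤ P x
  hasSum_one : HasSum P 1
  symmetric : IsZdSymmetric P
  zero : P 0 = 0
  lower : ∀ x, x ≠ 0 → Klb * L ^ α / tnorm L (toEuclid x) ^ ((d : ℝ) + α) ≤ P x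
  upper : ∀ x, x ≠ 0 → P x ≤ Kub * L ^ α / tnorm L (toEuclid x) ^ ((d : ℝ) + α)
  fourier_lt : ∀ k : Fin d → ℝ, (∀ i, k i ∈ Set.Ioc (-Real.pi) Real.pi) →
    1 - (fourier P k).re < 2 - Δ
  fourier_gt : ∀ k : Fin d → ℝ, (∀ i, k i ∈ Set.Ioc (-Real.pi) Real.pi) → L⁻¹ < ‖k‖ →
    Δ < 1 - (fourier P k).re

/-- The set of all paths in `ℤ^d` from `0` to `x`, of any length `n ≥ 0`. -/
def WalkPath {d : ℕ} (x : Fin d → ℤ) : Type :=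
  Σ n : ℕ, {ω : Fin (n + 1) → (Fin d → ℤ) // ω 0 = 0 ∧ ω (Fin.last n) = x}

/-- The random walk two-point function generated by `P`: the sum over all paths `ω` from `0` to
`x` of `∏ j, μ * P (ω_j - ω_{j-1})`, as an element of `[0, ∞]`. -/
def twoPoint {d : ℕ} (P : (Fin d → ℤ) → ℝ) (μ : ℝ) (x : Fin d → ℤ) : ℝ≥0∞ :=
  ∑' ω : WalkPath x, ENNReal.ofReal (∏ j : Fin ω.1, μ * P (ω.2.1 j.succ - ω.2.1 j.castSucc))

/-- The Kronecker delta `δ_{0,x}`. -/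
def delta {d : ℕ} (x : Fin d → ℤ) : ℝ≥0∞ :=
  if x = 0 then 1 else 0

end LongRange

end

/-!
For `μ ≤ 1` the two-point function is `∑ n, μ ^ n * p n x`, where `p n` is the `n`-step transition
probability of the walk with step law `P` (`twoPoint_eq`). Write `a = min α 2`, let `r` be the
regularised norm of `x` in units of `L`, and let `g` be the number of steps that the walk needs to
travel the distance `r`: `g = r ^ a`, or `g = r ^ 2 / log r` if `α = 2` (`growth`). Then the claim
is that `∑ n ≥ 1, μ ^ n * p n x` is at most a constant times
`(L * r) ^ (-d) * g * min 1 (1 / (g * (1 - μ)) ^ 2)`, and it follows from two bounds on `p n`.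

* Uniform bound (`exists_walk_le`): `p n x ≤ C * L ^ (-d) * n ^ (-d / a)`, with `n` replaced by
  `n * log (1 + n)` if `α = 2`. By Fourier inversion `p n x` is at most the integral of the `n`-th
  power of the absolute value of the Fourier transform. Outside the ball of radius `1 / L` the
  spectral gap makes this exponentially small in `n`, and two of the factors supply `L ^ (-d)` by
  Parseval. Inside that ball, `1` minus the Fourier transform at `k` is at least a multiple of
  `‖k‖ ^ 2` times the second moment of `P` truncated at `1 / ‖k‖` (`exists_le_one_sub_charFn`),
  and the lower bound on `P` bounds that moment from below; at `α = 2` the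
  logarithm comes from this truncated moment.

* Off-diagonal bound (`exists_walk_le_div_growth`): `p n x ≤ C * (L * r) ^ (-d) * (n / g)`. For
  `n ≥ g` this is weaker than the uniform bound. For `n < g`, a step longer than a small multiple
  of `‖x‖` happens at one of `n` times, and then has to hit a prescribed point, which costs
  `C * (L * r) ^ (-d) / g`. Without such steps, one half of the time has to cover half of the
  distance; Chernoff's bound, with an exponential moment governed by the truncated second moment,
  makes this as small as any prescribed power of `n / g` (`exists_walk_shortSteps_le`), and the
  uniform bound is applied to the other half of the time.

Summing the off-diagonal bound over `n ≤ g` and the uniform bound over `n ≥ g` gives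
`C * (L * r) ^ (-d) * g`; this uses `d > a`. For `μ < 1`, summing the off-diagonal bound over all
`n` against `∑ n * μ ^ n ≤ 1 / (1 - μ) ^ 2` gives the other term of the minimum.
-/

noncomputable section

namespace LongRange

/-! ### Convolution powers -/

section Walk

variable {G : Type*} [AddCommGroup G]

/-- The `n`-fold convolution power of `p`: the law after `n` steps of the walk with step law `p`,
started at `0`. Values in `[0, ∞]` make every sum meaningful and every exchange of sums free. -/
def walk (p : G → ℝ≥0∞) : ℕ → G → ℝ≥0∞
  | 0 => Set.indicator {0} 1
  | n + 1 => fun x => ∑' y, walk p n y * p (x - y)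

theorem walk_zero_apply (p : G → ℝ≥0∞) (x : G) : walk p 0 x = Set.indicator {0} 1 x := rfl

theorem walk_succ (p : G → ℝ≥0∞) (n : ℕ) (x : G) :
    walk p (n + 1) x = ∑' y, walk p n y * p (x - y) := rfl

theorem walk_zero_of_ne (p : G → ℝ≥0∞) {x : G} (hx : x ≠ 0) : walk p 0 x = 0 := by
  simp [walk_zero_apply, hx]

theorem walk_zero_zero (p : G → ℝ≥0∞) : walk p 0 0 = 1 := by
  simp [walk_zero_apply]

theorem walk_succ' (p : G → ℝ≥0∞) (n : ℕ) (x : G) :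
    walk p (n + 1) x = ∑' y, p y * walk p n (x - y) := by
  rw [walk_succ, ← (Equiv.subLeft x).tsum_eq]
  refine tsum_congr fun y => ?_
  simp [mul_comm]

theorem walk_one (p : G → ℝ≥0∞) (x : G) : walk p 1 x = p x := by
  rw [walk_succ, tsum_eq_single 0]
  · simp [walk_zero_zero]
  · intro y hy
    simp [walk_zero_of_ne p hy]

theorem walk_add (p : G → ℝ≥0∞) (m n : ℕ) (x : G) :
    walk p (m + n) x = ∑' y, walk p m y * walk p n (x - y) := by
  induction n generalizing x with
  | zero =>
    rw [tsum_eq_single x]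
    · simp [walk_zero_zero]
    · intro y hy
      rw [walk_zero_of_ne p (sub_ne_zero.2 hy.symm), mul_zero]
  | succ n ih =>
    rw [← add_assoc, walk_succ]
    simp_rw [ih, walk_succ, ← ENNReal.tsum_mul_right, ← ENNReal.tsum_mul_left]
    rw [ENNReal.tsum_comm]
    refine tsum_congr fun y => ?_
    rw [← (Equiv.addRight y).tsum_eq]
    refine tsum_congr fun z => ?_
    simp [mul_assoc, sub_sub, add_comm]

theorem walk_mono {p q : G → ℝ≥0∞} (h : ∀ x, p x ≤ q x) (n : ℕ) (x : G) :
    walk p n x ≤ walk q n x := by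
  induction n generalizing x with
  | zero => exact le_rfl
  | succ n ih => exact ENNReal.tsum_le_tsum fun y => mul_le_mul' (ih y) (h _)

/-- Moments against a character `e` are multiplicative in the number of steps. -/
theorem tsum_walk_mul (p e : G → ℝ≥0∞) (h0 : e 0 = 1) (hadd : ∀ x y, e (x + y) = e x * e y)
    (n : ℕ) : ∑' x, walk p n x * e x = (∑' x, p x * e x) ^ n := by
  induction n with
  | zero =>
    rw [tsum_eq_single 0]
    · simp [walk_zero_zero, h0]
    · intro y hy
      simp [walk_zero_of_ne p hy]
  | succ n ih =>
    simp_rw [walk_succ, ← ENNReal.tsum_mul_right]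
    rw [ENNReal.tsum_comm, pow_succ, ← ih, ← ENNReal.tsum_mul_right]
    refine tsum_congr fun y => ?_
    rw [← ENNReal.tsum_mul_left, ← (Equiv.addRight y).tsum_eq]
    refine tsum_congr fun x => ?_
    simp only [Equiv.coe_addRight, add_sub_cancel_right, hadd]
    ring

theorem tsum_walk (p : G → ℝ≥0∞) (n : ℕ) : ∑' x, walk p n x = (∑' x, p x) ^ n := by
  simpa using tsum_walk_mul p 1 rfl (by simp) n

/-- Splitting the steps into small ones `q` and large ones `b`: some large step occurs at one of
`n` times, and given all other steps it has to hit a prescribed point. -/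
theorem walk_add_le {q b : G → ℝ≥0∞} {β : ℝ≥0∞} (hb : ∀ x, b x ≤ β)
    (hsum : ∑' x, (q x + b x) ≤ 1) (n : ℕ) (x : G) :
    walk (fun x => q x + b x) n x ≤ walk q n x + n * β := by
  induction n generalizing x with
  | zero => simp [walk_zero_apply]
  | succ n ih =>
    have hq : ∑' y, q (x - y) ≤ 1 := by
      refine ((Equiv.subLeft x).tsum_eq q).le.trans ?_
      exact (ENNReal.tsum_le_tsum fun y => le_self_add).trans hsum
    have hw : ∑' y, walk (fun x => q x + b x) n y ≤ 1 := by
      rw [tsum_walk]; exact pow_le_one' hsum n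
    calc walk (fun x => q x + b x) (n + 1) x
        = ∑' y, walk (fun x => q x + b x) n y * (q (x - y) + b (x - y)) := rfl
      _ ≤ ∑' y, (walk q n y * q (x - y) + (n * β * q (x - y) +
            walk (fun x => q x + b x) n y * β)) := by
          refine ENNReal.tsum_le_tsum fun y => ?_
          rw [mul_add, ← add_assoc, ← add_mul]
          gcongr
          · exact ih y
          · exact hb _
      _ = walk q (n + 1) x + (n * β * ∑' y, q (x - y) +
            (∑' y, walk (fun x => q x + b x) n y) * β) := by
          rw [ENNReal.tsum_add, ENNReal.tsum_add, ENNReal.tsum_mul_left, ENNReal.tsum_mul_right,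
            walk_succ]
      _ ≤ walk q (n + 1) x + (n * β * 1 + 1 * β) := by gcongr
      _ = walk q (n + 1) x + ((n + 1 : ℕ) : ℝ≥0∞) * β := by push_cast; ring

/-- To reach `x` in `m + n` steps, one of the two partial displacements lies in `T`, provided that
`T` or its reflection through `x / 2` contains every point. -/
theorem walk_add_le_of_tail (p : G → ℝ≥0∞) {m n : ℕ} {β τ : ℝ≥0∞} {x : G} {T : Set G}
    (hT : ∀ y, y ∈ T ∨ x - y ∈ T) (hm : ∀ y, walk p m y ≤ β) (hn : ∀ y, walk p n y ≤ β)
    (hm' : ∑' y, T.indicator (walk p m) y ≤ τ) (hn' : ∑' y, T.indicator (walk p n) y ≤ τ) :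
    walk p (m + n) x ≤ 2 * (τ * β) := by
  have hn'' : ∑' y, T.indicator (walk p n) (x - y) ≤ τ := 
    ((Equiv.subLeft x).tsum_eq (T.indicator (walk p n))).le.trans hn'
  calc walk p (m + n) x
      ≤ ∑' y, (T.indicator (walk p m) y * β + β * T.indicator (walk p n) (x - y)) := by
        rw [walk_add]
        refine ENNReal.tsum_le_tsum fun y => ?_
        rcases hT y with h | h
        · rw [Set.indicator_of_mem h]
          exact (mul_le_mul' le_rfl (hn _)).trans le_self_add
        · rw [Set.indicator_of_mem h]
          exact (mul_le_mul' (hm _) le_rfl).trans le_add_self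
    _ ≤ τ * β + β * τ := by
        rw [ENNReal.tsum_add, ENNReal.tsum_mul_left, ENNReal.tsum_mul_right]
        gcongr
    _ = 2 * (τ * β) := by ring

end Walk

/-! ### Path sums as convolution powers -/

section Path

variable {d : ℕ}

/-- Paths with `n` steps from `0` to `x`. -/
abbrev PathTo (n : ℕ) (x : Fin d → ℤ) : Type :=
  {ω : Fin (n + 1) → (Fin d → ℤ) // ω 0 = 0 ∧ ω (Fin.last n) = x}

/-- A path with `n + 1` steps is a path with `n` steps followed by a last step. -/
def pathSnoc (n : ℕ) (x : Fin d → ℤ) :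
    (Σ y : Fin d → ℤ, PathTo n y) ≃ PathTo (n + 1) x where
  toFun s := ⟨Fin.snoc s.2.1 x, by
    refine ⟨?_, by simp⟩
    exact (Fin.snoc_castSucc (α := fun _ => Fin d → ℤ) x s.2.1 0).trans s.2.2.1⟩
  invFun ω := ⟨ω.1 (Fin.last n).castSucc, fun j => ω.1 j.castSucc, ω.2.1, rfl⟩
  left_inv := by
    rintro ⟨y, ω, h0, rfl⟩
    have h : (fun j => (Fin.snoc (α := fun _ => Fin d → ℤ) ω x : _ → _) (Fin.castSucc j)) = ω :=
      funext fun j => Fin.snoc_castSucc (α := fun _ => Fin d → ℤ) x ω j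
    exact Sigma.subtype_ext (congrFun h (Fin.last n)) h
  right_inv := by
    rintro ⟨ω, h0, rfl⟩
    apply Subtype.ext
    exact Fin.snoc_init_self ω

theorem tsum_path (P : (Fin d → ℤ) → ℝ) (hP : ∀ x, 0 ≤ P x) {μ : ℝ} (hμ : 0 ≤ μ) (n : ℕ)
    (x : Fin d → ℤ) :
    ∑' ω : PathTo n x, ENNReal.ofReal (∏ j : Fin n, μ * P (ω.1 j.succ - ω.1 j.castSucc)) =
      ENNReal.ofReal μ ^ n * walk (fun y => ENNReal.ofReal (P y)) n x := by
  induction n generalizing x with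
  | zero =>
    by_cases hx : x = 0
    · subst hx
      have : Unique (PathTo 0 (0 : Fin d → ℤ)) :=
        { default := ⟨fun _ => 0, rfl, rfl⟩
          uniq := fun ω => Subtype.ext (funext fun j => by
            have hj : j = 0 := Fin.ext (by omega)
            rw [hj]; exact ω.2.1) }
      rw [tsum_fintype]
      simp [walk_zero_zero]
    · have : IsEmpty (PathTo 0 x) := ⟨fun ω => hx (ω.2.2.symm.trans ω.2.1)⟩
      simp [walk_zero_of_ne _ hx]
  | succ n ih =>
    rw [← (pathSnoc n x).tsum_eq, ENNReal.tsum_sigma', walk_succ, ← ENNReal.tsum_mul_left]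
    refine tsum_congr fun y => ?_
    rw [pow_succ, show ENNReal.ofReal μ ^ n * ENNReal.ofReal μ *
      (walk (fun y => ENNReal.ofReal (P y)) n y * ENNReal.ofReal (P (x - y))) =
      (ENNReal.ofReal μ ^ n * walk (fun y => ENNReal.ofReal (P y)) n y) *
        (ENNReal.ofReal μ * ENNReal.ofReal (P (x - y))) by ring, ← ih y, ← ENNReal.tsum_mul_right]
    refine tsum_congr fun ω => ?_
    obtain ⟨ω, h0, rfl⟩ := ω
    rw [Fin.prod_univ_castSucc, ENNReal.ofReal_mul
      (Finset.prod_nonneg fun j _ => mul_nonneg hμ (hP _)), ENNReal.ofReal_mul hμ]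
    simp [pathSnoc, Fin.snoc_castSucc, ← Fin.castSucc_succ]

theorem twoPoint_eq (P : (Fin d → ℤ) → ℝ) (hP : ∀ x, 0 ≤ P x) {μ : ℝ} (hμ : 0 ≤ μ)
    (x : Fin d → ℤ) :
    twoPoint P μ x =
      ∑' n, ENNReal.ofReal μ ^ n * walk (fun y => ENNReal.ofReal (P y)) n x := by
  rw [twoPoint]
  exact (ENNReal.tsum_sigma' _).trans (tsum_congr fun n => tsum_path P hP hμ n x)

end Path

/-! ### One-dimensional sums -/

/-- Partial sums of `m ^ (e - 1)`, with `e > 0`, by telescoping `m ^ e`. -/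
theorem exists_sum_rpow_le {e : ℝ} (he : 0 < e) :
    ∃ C : ℝ, 0 < C ∧ ∀ N : ℕ, ∑ j ∈ Finset.range N, ((j : ℝ) + 1) ^ (e - 1) ≤ C * (N : ℝ) ^ e := by
  refine ⟨max 1 (2 ^ e / e), by positivity, fun N => ?_⟩
  induction N with
  | zero => simp [Real.zero_rpow he.ne']
  | succ n ih =>
    rw [Finset.sum_range_succ]
    push_cast
    suffices h : ((n : ℝ) + 1) ^ (e - 1) ≤
        max 1 (2 ^ e / e) * (((n : ℝ) + 1) ^ e - (n : ℝ) ^ e) by linarith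
    rcases Nat.eq_zero_or_pos n with rfl | hn
    · simp [Real.zero_rpow he.ne']
    · have hn' : (1 : ℝ) ≤ n := by exact_mod_cast hn
      have hn0 : (0 : ℝ) < n := by linarith
      have h1 : (1 : ℝ) / (n + 1) ≤ Real.log ((n + 1) / n) := by
        have := Real.one_sub_inv_le_log_of_pos (x := ((n : ℝ) + 1) / n) (by positivity)
        refine le_trans (le_of_eq ?_) this
        field_simp
        ring
      have h2 : 1 + e / (n + 1) ≤ (((n : ℝ) + 1) / n) ^ e := by
        rw [Real.rpow_def_of_pos (by positivity)]
        refine le_trans ?_ (Real.add_one_le_exp _)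
        have := mul_le_mul_of_nonneg_right h1 he.le
        have h3 : (1 : ℝ) / (n + 1) * e = e / (n + 1) := by ring
        linarith
      have h3 : (n : ℝ) ^ e * (1 + e / (n + 1)) ≤ ((n : ℝ) + 1) ^ e := by
        refine (mul_le_mul_of_nonneg_left h2 (by positivity)).trans (le_of_eq ?_)
        rw [← Real.mul_rpow (by positivity) (by positivity)]
        congr 1
        field_simp
      have h4 : ((n : ℝ) + 1) ^ e ≤ 2 ^ e * (n : ℝ) ^ e := by
        rw [← Real.mul_rpow (by norm_num) (by positivity)]
        exact Real.rpow_le_rpow (by positivity) (by linarith) he.le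
      have h5 : ((n : ℝ) + 1) ^ (e - 1) = ((n : ℝ) + 1) ^ e / (n + 1) := by
        rw [Real.rpow_sub (by positivity), Real.rpow_one]
      calc ((n : ℝ) + 1) ^ (e - 1) = ((n : ℝ) + 1) ^ e / (n + 1) := h5
        _ ≤ 2 ^ e * (n : ℝ) ^ e / (n + 1) := by gcongr
        _ = 2 ^ e / e * ((n : ℝ) ^ e * (e / (n + 1))) := by field_simp
        _ ≤ 2 ^ e / e * (((n : ℝ) + 1) ^ e - (n : ℝ) ^ e) := by
            gcongr
            linarith
        _ ≤ _ := by
            gcongr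
            · have : (0:ℝ) < (n : ℝ) ^ e * (e / (n + 1)) := by positivity
              linarith
            · exact le_max_right _ _

/-- Tails of `∑ m ^ (-s)`, with `s > 1`, by telescoping `m ^ (1 - s)`. -/
theorem exists_sum_tail_le {s : ℝ} (hs : 1 < s) :
    ∃ C : ℝ, 0 < C ∧ ∀ y : ℝ, 1 ≤ y → ∀ N : ℕ,
      ∑ j ∈ Finset.range N, (if y ≤ (j : ℝ) + 1 then ((j : ℝ) + 1) ^ (-s) else 0) ≤
        C * y ^ (1 - s) := by
  have hs0 : 0 < s - 1 := by linarith
  refine ⟨2 * (1 + (s - 1) / 2) / (s - 1), by positivity, fun y hy N => ?_⟩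
  set C := 2 * (1 + (s - 1) / 2) / (s - 1) with hC
  have hC0 : 0 < C := by positivity
  -- the cutoff at `y` discards the increments of the terms that are not in the tail
  let G : ℕ → ℝ := fun n => C * (max ((n : ℝ) + 1) y) ^ (1 - s)
  have hG : ∀ n, 0 ≤ G n := fun n => by positivity
  have key : ∀ j : ℕ, (if y ≤ (j : ℝ) + 1 then ((j : ℝ) + 1) ^ (-s) else 0) ≤
      G j - G (j + 1) := by
    intro j
    split_ifs with h
    · have hm : (0 : ℝ) < (j : ℝ) + 1 := by positivity
      have hm1 : (1 : ℝ) ≤ (j : ℝ) + 1 := by linarith [(Nat.cast_nonneg j : (0:ℝ) ≤ j)]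
      simp only [G]
      push_cast
      rw [max_eq_left h, max_eq_left (by linarith)]
      set m : ℝ := (j : ℝ) + 1
      have h1 : 1 / (2 * m) ≤ Real.log ((m + 1) / m) := by
        have := Real.one_sub_inv_le_log_of_pos (x := (m + 1) / m) (by positivity)
        refine le_trans ?_ this
        rw [inv_div, one_sub_div (by positivity), add_sub_cancel_left]
        exact one_div_le_one_div_of_le (by positivity) (by linarith)
      have h2 : 1 + (s - 1) / (2 * m) ≤ ((m + 1) / m) ^ (s - 1) := by
        rw [Real.rpow_def_of_pos (by positivity)]
        refine le_trans ?_ (Real.add_one_le_exp _)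
        have := mul_le_mul_of_nonneg_right h1 hs0.le
        have h3 : 1 / (2 * m) * (s - 1) = (s - 1) / (2 * m) := by ring
        linarith
      have h3 : (m + 1) ^ (1 - s) = m ^ (1 - s) * (((m + 1) / m) ^ (s - 1))⁻¹ := by
        rw [← Real.rpow_neg (by positivity), Real.div_rpow (by positivity) (by positivity),
          neg_sub]
        field_simp
      have h4 : (((m + 1) / m) ^ (s - 1))⁻¹ ≤ (1 + (s - 1) / (2 * m))⁻¹ :=
        inv_anti₀ (by positivity) h2
      have h5 : m ^ (-s) = m ^ (1 - s) / m := by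
        rw [show -s = (1 - s) - 1 by ring, Real.rpow_sub hm, Real.rpow_one]
      have h6 : 1 / m ≤ C * (1 - (1 + (s - 1) / (2 * m))⁻¹) := by
        have : 1 - (1 + (s - 1) / (2 * m))⁻¹ = (s - 1) / (2 * m + (s - 1)) := by
          field_simp
          ring
        rw [this, hC, ← mul_div_assoc, div_mul_cancel₀ _ hs0.ne',
          div_le_div_iff₀ hm (by positivity)]
        nlinarith
      have hp : 0 < m ^ (1 - s) := by positivity
      rw [h5, h3, ← mul_sub]
      calc m ^ (1 - s) / m = m ^ (1 - s) * (1 / m) := by ring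
        _ ≤ m ^ (1 - s) * (C * (1 - (1 + (s - 1) / (2 * m))⁻¹)) := by gcongr
        _ ≤ m ^ (1 - s) * (C * (1 - (((m + 1) / m) ^ (s - 1))⁻¹)) := by gcongr
        _ = _ := by ring
    · have : G (j + 1) ≤ G j := by
        simp only [G]
        refine mul_le_mul_of_nonneg_left ?_ hC0.le
        apply Real.rpow_le_rpow_of_nonpos (by positivity)
        · push_cast; gcongr; linarith
        · linarith
      linarith
  calc _ ≤ ∑ j ∈ Finset.range N, (G j - G (j + 1)) := Finset.sum_le_sum fun j _ => key j
    _ = G 0 - G N := Finset.sum_range_sub' G N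
    _ ≤ G 0 := by linarith [hG N]
    _ = C * y ^ (1 - s) := by simp [G, max_eq_right hy]

theorem pow_div_le_sum_pow (k N : ℕ) :
    (N : ℝ) ^ (k + 1) / (k + 1) ≤ ∑ j ∈ Finset.range N, ((j : ℝ) + 1) ^ k := by
  induction N with
  | zero => simp
  | succ n ih =>
    rw [Finset.sum_range_succ]
    have h : ((n : ℝ) + 1) ^ (k + 1) ≤ (n : ℝ) ^ (k + 1) + (k + 1) * ((n : ℝ) + 1) ^ k := by
      clear ih
      induction k with
      | zero => simp
      | succ k ih =>
        have hn : (0 : ℝ) ≤ n := Nat.cast_nonneg n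
        have h1 : (n : ℝ) ^ (k + 1) ≤ ((n : ℝ) + 1) ^ (k + 1) := by gcongr; linarith
        have := mul_le_mul_of_nonneg_right ih (by positivity : (0 : ℝ) ≤ (n : ℝ) + 1)
        push_cast
        have e1 : ((n : ℝ) + 1) ^ (k + 1 + 1) = ((n : ℝ) + 1) ^ (k + 1) * (n + 1) := pow_succ _ _
        have e2 : (n : ℝ) ^ (k + 1 + 1) = (n : ℝ) ^ (k + 1) * n := pow_succ _ _
        have e3 : ((n : ℝ) + 1) ^ (k + 1) = ((n : ℝ) + 1) ^ k * (n + 1) := pow_succ _ _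
        nlinarith
    push_cast
    have hk : (0 : ℝ) < (k : ℝ) + 1 := by positivity
    calc ((n : ℝ) + 1) ^ (k + 1) / (k + 1)
        ≤ ((n : ℝ) ^ (k + 1) + (k + 1) * ((n : ℝ) + 1) ^ k) / (k + 1) := by gcongr
      _ = (n : ℝ) ^ (k + 1) / (k + 1) + ((n : ℝ) + 1) ^ k := by field_simp
      _ ≤ _ := by linarith

/-! ### Truncated second moments of the power law -/

/-- The logarithmic correction, at the critical exponent `α = 2`, to the second moment truncated at
`s` times the range. -/
def slow (α s : ℝ) : ℝ := if α = 2 then 1 + Real.log s else 1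

/-- The radial profile `L ^ α / max s L ^ (d + α)` of the power law with range `L`. -/
def profile (d : ℕ) (α L s : ℝ) : ℝ := L ^ α / (max s L) ^ ((d : ℝ) + α)

theorem profile_pos (d : ℕ) (α : ℝ) {L : ℝ} (hL : 1 ≤ L) (s : ℝ) : 0 < profile d α L s := by
  unfold profile
  have : 0 < max s L := lt_max_of_lt_right (by linarith)
  positivity

/-- The second moment of the power law within radius `N`, as a sum over the radii `m = j + 1`: a
sphere of radius `m` has of order `m ^ (d - 1)` points, each of which contributes `m ^ 2` times the
profile. -/
def radial (d : ℕ) (α L : ℝ) (N : ℕ) : ℝ :=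
  ∑ j ∈ Finset.range N, ((j : ℝ) + 1) ^ (d + 1) * profile d α L (j + 1)

section Radial

variable {d : ℕ} {α : ℝ}

theorem pow_mul_profile_le_id (hα : 0 < α) {L m : ℝ} (hL : 1 ≤ L) (hm : 1 ≤ m) :
    m ^ (d + 1) * profile d α L m ≤ m := by
  have hL0 : 0 < L := by linarith
  have hm0 : 0 < m := by linarith
  have hM : 0 < max m L := lt_max_of_lt_left hm0
  have h : m ^ d * L ^ α ≤ max m L ^ ((d : ℝ) + α) := by
    rw [Real.rpow_add hM, Real.rpow_natCast]
    gcongr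
    · exact le_max_left _ _
    · exact le_max_right _ _
  unfold profile
  rw [← mul_div_assoc, div_le_iff₀ (by positivity), pow_succ]
  nlinarith

theorem pow_mul_profile_le_rpow (hα : 0 < α) {L m : ℝ} (hL : 1 ≤ L) (hm : 1 ≤ m) :
    m ^ (d + 1) * profile d α L m ≤ L ^ α * m ^ (1 - α) := by
  have hL0 : 0 < L := by linarith
  have hm0 : 0 < m := by linarith
  have h : m ^ ((d : ℝ) + α) ≤ max m L ^ ((d : ℝ) + α) :=
    Real.rpow_le_rpow hm0.le (le_max_left _ _) (by positivity)
  have e : m ^ (d + 1) = m ^ (1 - α) * m ^ ((d : ℝ) + α) := by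
    rw [← Real.rpow_add hm0, ← Real.rpow_natCast]
    congr 1
    push_cast
    ring
  unfold profile
  rw [← mul_div_assoc, div_le_iff₀ (by positivity), e]
  have : 0 ≤ L ^ α * m ^ (1 - α) := by positivity
  nlinarith [mul_le_mul_of_nonneg_left h this]

theorem radial_mono {L : ℝ} (hL : 1 ≤ L) : Monotone (radial d α L) := by
  intro M N h
  refine Finset.sum_le_sum_of_subset_of_nonneg (Finset.range_mono h) fun j _ _ => ?_
  have := profile_pos d α hL ((j : ℝ) + 1)
  positivity

theorem exists_radial_le (d : ℕ) (hα : 0 < α) :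
    ∃ C : ℝ, 0 < C ∧ ∀ L ρ : ℝ, 1 ≤ L → L ≤ ρ → ∀ N : ℕ, (N : ℝ) ≤ ρ →
      radial d α L N ≤ C * (L ^ 2 * (ρ / L) ^ (2 - min α 2) * slow α (ρ / L)) := by
  rcases lt_trichotomy α 2 with h | rfl | h
  · obtain ⟨C, hC, hsum⟩ := exists_sum_rpow_le (e := 2 - α) (by linarith)
    refine ⟨C, hC, fun L ρ hL hρ N hN => ?_⟩
    have hL0 : 0 < L := by linarith
    have hρ0 : 0 < ρ := by linarith
    rw [min_eq_left h.le, slow, if_neg h.ne, mul_one]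
    calc radial d α L N ≤ ∑ j ∈ Finset.range N, L ^ α * ((j : ℝ) + 1) ^ ((2 - α) - 1) := by
          refine Finset.sum_le_sum fun j _ => ?_
          rw [show (2 - α) - 1 = 1 - α by ring]
          exact pow_mul_profile_le_rpow hα hL (by linarith [(Nat.cast_nonneg j : (0:ℝ) ≤ j)])
      _ ≤ L ^ α * (C * (N : ℝ) ^ (2 - α)) := by
          rw [← Finset.mul_sum]
          gcongr
          exact hsum N
      _ ≤ L ^ α * (C * ρ ^ (2 - α)) := by
          gcongr
      _ = C * (L ^ 2 * (ρ / L) ^ (2 - α)) := by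
          rw [Real.div_rpow hρ0.le hL0.le, Real.rpow_sub hL0, Real.rpow_two]
          field_simp
  · refine ⟨4, by norm_num, fun L ρ hL hρ N hN => ?_⟩
    have hL0 : 0 < L := by linarith
    have hρ0 : 0 < ρ := by linarith
    -- a potential whose increments are comparable to `min m (L ^ 2 / m)`
    let H : ℕ → ℝ := fun n => 2 * L ^ 2 * Real.log (L ^ 2 + (n : ℝ) ^ 2)
    have key : ∀ j : ℕ, ((j : ℝ) + 1) ^ (d + 1) * profile d 2 L (j + 1) ≤ H (j + 1) - H j := by
      intro j
      have hj : (0 : ℝ) ≤ j := Nat.cast_nonneg j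
      set m : ℝ := (j : ℝ) + 1 with hm
      have hm1 : 1 ≤ m := by linarith
      have hm0 : 0 < m := by linarith
      have h1 := pow_mul_profile_le_id (d := d) (by norm_num : (0 : ℝ) < 2) hL hm1
      have h2 := pow_mul_profile_le_rpow (d := d) (by norm_num : (0 : ℝ) < 2) hL hm1
      rw [show (1 : ℝ) - 2 = -1 by norm_num, Real.rpow_neg_one, Real.rpow_two] at h2
      have h2' : m ^ (d + 1) * profile d 2 L m * m ^ 2 ≤ L ^ 2 * m := by
        have := mul_le_mul_of_nonneg_right h2 (by positivity : 0 ≤ m ^ 2)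
        refine this.trans (le_of_eq ?_)
        field_simp
      have h3 : m ^ (d + 1) * profile d 2 L m ≤ 2 * L ^ 2 * (m / (L ^ 2 + m ^ 2)) := by
        rw [← mul_div_assoc, le_div_iff₀ (by positivity)]
        nlinarith [mul_le_mul_of_nonneg_right h1 (by positivity : 0 ≤ L ^ 2)]
      have h4 : m / (L ^ 2 + m ^ 2) ≤ Real.log ((L ^ 2 + m ^ 2) / (L ^ 2 + (j : ℝ) ^ 2)) := by
        refine le_trans ?_ (Real.one_sub_inv_le_log_of_pos (by positivity))
        rw [inv_div, one_sub_div (by positivity)]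
        gcongr
        nlinarith
      rw [Real.log_div (by positivity) (by positivity)] at h4
      simp only [H]
      push_cast
      rw [← hm, ← mul_sub]
      exact h3.trans (by gcongr)
    rw [min_self, sub_self, Real.rpow_zero, mul_one, slow, if_pos rfl]
    have hH : H N ≤ 2 * L ^ 2 * (Real.log 2 + 2 * Real.log ρ) := by
      have : Real.log 2 + 2 * Real.log ρ = Real.log (2 * ρ ^ 2) := by
        rw [Real.log_mul (by norm_num) (by positivity), Real.log_pow]
        norm_num
      rw [this]
      simp only [H]
      gcongr
      nlinarith [(Nat.cast_nonneg N : (0:ℝ) ≤ N)]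
    have hH0 : H 0 = 2 * L ^ 2 * (2 * Real.log L) := by
      simp [H, Real.log_pow]
    calc radial d 2 L N ≤ ∑ j ∈ Finset.range N, (H (j + 1) - H j) :=
          Finset.sum_le_sum fun j _ => key j
      _ = H N - H 0 := Finset.sum_range_sub H N
      _ ≤ 2 * L ^ 2 * (Real.log 2 + 2 * Real.log ρ) - 2 * L ^ 2 * (2 * Real.log L) := by
          rw [hH0]; linarith
      _ ≤ 4 * (L ^ 2 * (1 + Real.log (ρ / L))) := by
          rw [Real.log_div (by positivity) (by positivity)]
          have : Real.log 2 ≤ 1 := by linarith [Real.log_two_lt_d9]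
          nlinarith [sq_nonneg L]
  · obtain ⟨C, hC, hsum⟩ := exists_sum_tail_le (s := α - 1) (by linarith)
    refine ⟨1 + C, by positivity, fun L ρ hL hρ N hN => ?_⟩
    have hL0 : 0 < L := by linarith
    rw [min_eq_right h.le, sub_self, Real.rpow_zero, mul_one, slow, if_neg h.ne', mul_one]
    -- the terms with `m ≤ L` are at most `m ≤ m ^ 2 - (m - 1) ^ 2`, the others are a tail sum
    let H : ℕ → ℝ := fun n => (min (n : ℝ) L) ^ 2
    have key : ∀ j : ℕ, ((j : ℝ) + 1) ^ (d + 1) * profile d α L (j + 1) ≤ (H (j + 1) - H j) +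
        L ^ α * (if L ≤ (j : ℝ) + 1 then ((j : ℝ) + 1) ^ (-(α - 1)) else 0) := by
      intro j
      have hj : (0 : ℝ) ≤ j := Nat.cast_nonneg j
      have h1 : H j ≤ H (j + 1) := by
        simp only [H]
        push_cast
        have : 0 ≤ min (j : ℝ) L := le_min hj hL0.le
        gcongr
        linarith
      split_ifs with hL'
      · rw [show -(α - 1) = 1 - α by ring]
        have := pow_mul_profile_le_rpow (d := d) hα hL (by linarith : 1 ≤ (j : ℝ) + 1)
        linarith
      · refine (pow_mul_profile_le_id hα hL (by linarith)).trans ?_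
        simp only [H]
        push_cast
        rw [min_eq_left (by linarith), min_eq_left (by linarith)]
        nlinarith
    have hHN : H N ≤ L ^ 2 := by
      simp only [H]
      have : 0 ≤ min (N : ℝ) L := le_min (Nat.cast_nonneg N) hL0.le
      gcongr
      exact min_le_right _ _
    have hH0 : H 0 = 0 := by simp [H, hL0.le]
    calc radial d α L N ≤ _ := Finset.sum_le_sum fun j _ => key j
      _ = (H N - H 0) + L ^ α * ∑ j ∈ Finset.range N,
            (if L ≤ (j : ℝ) + 1 then ((j : ℝ) + 1) ^ (-(α - 1)) else 0) := by
          rw [Finset.sum_add_distrib, Finset.sum_range_sub, ← Finset.mul_sum]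
      _ ≤ L ^ 2 + L ^ α * (C * L ^ (1 - (α - 1))) := by
          gcongr
          · linarith
          · exact hsum L hL N
      _ = (1 + C) * L ^ 2 := by
          rw [show 1 - (α - 1) = 2 - α by ring, Real.rpow_sub hL0, Real.rpow_two]
          field_simp

theorem exists_le_radial (d : ℕ) (hα : 0 < α) :
    ∃ c : ℝ, 0 < c ∧ ∀ L ρ : ℝ, 1 ≤ L → L ≤ ρ →
      c * (L ^ 2 * (ρ / L) ^ (2 - min α 2) * slow α (ρ / L)) ≤ radial d α L ⌊ρ⌋₊ := by
  -- the outermost shells, whose radii are comparable to `ρ`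
  have outer : ∃ c : ℝ, 0 < c ∧ ∀ L ρ : ℝ, 1 ≤ L → L ≤ ρ →
      c * (L ^ 2 * (ρ / L) ^ (2 - α)) ≤ radial d α L ⌊ρ⌋₊ := by
    refine ⟨1 / (2 ^ (d + 2) * (d + 2)), by positivity, fun L ρ hL hρ => ?_⟩
    have hL0 : 0 < L := by linarith
    have hρ0 : 0 < ρ := by linarith
    have hN : ρ / 2 ≤ (⌊ρ⌋₊ : ℝ) := by
      have h1 := Nat.lt_floor_add_one ρ
      have h2 : (1 : ℝ) ≤ (⌊ρ⌋₊ : ℝ) := by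
        exact_mod_cast Nat.le_floor (by simpa using hL.trans hρ)
      linarith
    have hs := pow_div_le_sum_pow (d + 1) ⌊ρ⌋₊
    calc 1 / (2 ^ (d + 2) * (d + 2)) * (L ^ 2 * (ρ / L) ^ (2 - α))
        = ((ρ / 2) ^ (d + 1 + 1) / ((d + 1 : ℕ) + 1)) * (L ^ α / ρ ^ ((d : ℝ) + α)) := by
          rw [Real.div_rpow hρ0.le hL0.le, Real.rpow_sub hL0, Real.rpow_sub hρ0, Real.rpow_two,
            Real.rpow_two, Real.rpow_add hρ0, Real.rpow_natCast, div_pow]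
          push_cast
          field_simp
          ring
      _ ≤ (∑ j ∈ Finset.range ⌊ρ⌋₊, ((j : ℝ) + 1) ^ (d + 1)) * (L ^ α / ρ ^ ((d : ℝ) + α)) := by
          gcongr
          refine le_trans ?_ hs
          gcongr
      _ ≤ radial d α L ⌊ρ⌋₊ := by
          rw [Finset.sum_mul]
          refine Finset.sum_le_sum fun j hj => ?_
          have hj' : ((j : ℝ) + 1) ≤ ρ := by
            have : j + 1 ≤ ⌊ρ⌋₊ := Finset.mem_range.1 hj
            have h2 : ((j + 1 : ℕ) : ℝ) ≤ ⌊ρ⌋₊ := by exact_mod_cast this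
            push_cast at h2
            exact h2.trans (Nat.floor_le hρ0.le)
          unfold profile
          have : 0 < max ((j : ℝ) + 1) L := lt_max_of_lt_right hL0
          gcongr
          exact max_le hj' hρ
  obtain ⟨c, hc, hout⟩ := outer
  -- the shells of radius at most `L`
  have inner : ∀ L ρ : ℝ, 1 ≤ L → L ≤ ρ → c * L ^ 2 ≤ radial d α L ⌊ρ⌋₊ := by
    intro L ρ hL hρ
    have := hout L L hL le_rfl
    rw [div_self (by linarith), Real.one_rpow, mul_one] at this
    exact this.trans (radial_mono hL (Nat.floor_le_floor hρ))
  rcases lt_trichotomy α 2 with h | rfl | h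
  · refine ⟨c, hc, fun L ρ hL hρ => ?_⟩
    rw [min_eq_left h.le, slow, if_neg h.ne, mul_one]
    exact hout L ρ hL hρ
  · have hlog : ∀ L ρ : ℝ, 1 ≤ L → L ≤ ρ →
        L ^ 2 * (Real.log (ρ / L) - Real.log 2) ≤ radial d 2 L ⌊ρ⌋₊ := by
      intro L ρ hL hρ
      have hL0 : 0 < L := by linarith
      have hρ0 : 0 < ρ := by linarith
      -- the cutoff at `2 * L` leaves only increments at `m ≥ L`, where each term is `L ^ 2 / m`
      let H : ℕ → ℝ := fun n => L ^ 2 * Real.log (max ((n : ℝ) + 1) (2 * L))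
      have key : ∀ j : ℕ, H (j + 1) - H j ≤ ((j : ℝ) + 1) ^ (d + 1) * profile d 2 L (j + 1) := by
        intro j
        have hj : (0 : ℝ) ≤ j := Nat.cast_nonneg j
        simp only [H]
        push_cast
        set m : ℝ := (j : ℝ) + 1 with hm
        have hm0 : 0 < m := by linarith
        have hp := profile_pos d 2 hL m
        by_cases hmL : m < L
        · rw [max_eq_right (by linarith), max_eq_right (by linarith), sub_self]
          positivity
        · rw [not_lt] at hmL
          have h0 : m ^ (d + 1) * profile d 2 L m = L ^ 2 * (1 / m) := by
            unfold profile
            rw [max_eq_left hmL, Real.rpow_add hm0, Real.rpow_two, Real.rpow_two,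
              Real.rpow_natCast]
            field_simp
            ring
          rw [h0, ← mul_sub]
          gcongr
          have hM : 0 < max m (2 * L) := lt_max_of_lt_left hm0
          rw [← Real.log_div (by positivity) (by positivity)]
          refine (Real.log_le_sub_one_of_pos (by positivity)).trans ?_
          rw [div_sub_one (by positivity), div_le_div_iff₀ (by positivity) hm0, one_mul]
          have : max (m + 1) (2 * L) ≤ max m (2 * L) + 1 :=
            max_le (by linarith [le_max_left m (2 * L)]) (by linarith [le_max_right m (2 * L)])
          nlinarith [le_max_left m (2 * L)]
      have hsum : H ⌊ρ⌋₊ - H 0 ≤ radial d 2 L ⌊ρ⌋₊ := by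
        rw [← Finset.sum_range_sub H]
        exact Finset.sum_le_sum fun j _ => key j
      refine le_trans ?_ hsum
      simp only [H]
      rw [← mul_sub]
      refine mul_le_mul_of_nonneg_left ?_ (by positivity)
      have h0 : max (((0 : ℕ) : ℝ) + 1) (2 * L) = 2 * L :=
        max_eq_right (by push_cast; linarith)
      rw [h0, Real.log_mul (by norm_num) hL0.ne', Real.log_div hρ0.ne' hL0.ne']
      have : Real.log ρ ≤ Real.log (max ((⌊ρ⌋₊ : ℝ) + 1) (2 * L)) :=
        Real.log_le_log hρ0 ((Nat.lt_floor_add_one ρ).le.trans (le_max_left _ _))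
      linarith
    refine ⟨1 / (2 / c + 1), by positivity, fun L ρ hL hρ => ?_⟩
    have h1 := inner L ρ hL hρ
    have h2 := hlog L ρ hL hρ
    have h2' : Real.log 2 ≤ 1 := by linarith [Real.log_two_lt_d9]
    rw [min_self, sub_self, Real.rpow_zero, mul_one, slow, if_pos rfl, one_div_mul_eq_div,
      div_le_iff₀ (by positivity)]
    have h3 : 2 * L ^ 2 ≤ radial d 2 L ⌊ρ⌋₊ * (2 / c) := by
      rw [← mul_div_assoc, le_div_iff₀ hc]
      linarith
    nlinarith [sq_nonneg L]
  · refine ⟨c, hc, fun L ρ hL hρ => ?_⟩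
    rw [min_eq_right h.le, sub_self, Real.rpow_zero, mul_one, slow, if_neg h.ne', mul_one]
    exact inner L ρ hL hρ

end Radial

/-! ### Sums over boxes in the lattice -/

section Box

variable {d : ℕ}

theorem exists_norm_apply_eq {E : Type*} [SeminormedAddGroup E] (hd : 0 < d) (x : Fin d → E) :
    ∃ i, ‖x i‖ = ‖x‖ := by
  obtain ⟨j, -, hj⟩ := Finset.exists_max_image Finset.univ (fun j => ‖x j‖)
    ⟨⟨0, hd⟩, Finset.mem_univ _⟩
  exact ⟨j, le_antisymm (norm_le_pi_norm x j)
    ((pi_norm_le_iff_of_nonneg (norm_nonneg _)).2 fun k => hj k (Finset.mem_univ k))⟩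

/-- The box of lattice points whose coordinates are at most `N` in absolute value. -/
def box (d N : ℕ) : Finset (Fin d → ℤ) := Fintype.piFinset fun _ => Finset.Icc (-(N : ℤ)) N

theorem mem_box {N : ℕ} {x : Fin d → ℤ} : x ∈ box d N ↔ ∀ i, |x i| ≤ N := by
  simp [box, Fintype.mem_piFinset, abs_le]

theorem mem_box_iff_norm {N : ℕ} {x : Fin d → ℤ} : x ∈ box d N ↔ ‖x‖ ≤ N := by
  rw [mem_box, pi_norm_le_iff_of_nonneg (by positivity)]
  refine forall_congr' fun i => ?_
  rw [Int.norm_eq_abs]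
  exact_mod_cast Iff.rfl

theorem card_box (d N : ℕ) : (box d N).card = (2 * N + 1) ^ d := by
  rw [box, Fintype.card_piFinset_const, Int.card_Icc]
  congr 1
  omega

theorem box_mono {M N : ℕ} (h : M ≤ N) : box d M ⊆ box d N := fun x hx => by
  rw [mem_box_iff_norm] at *
  exact hx.trans (by exact_mod_cast h)

/-- The number of lattice points with sup norm `N + 1`. -/
def shellCard (d N : ℕ) : ℝ := (2 * (N : ℝ) + 3) ^ d - (2 * (N : ℝ) + 1) ^ d

theorem sum_box_succ (f : ℝ → ℝ) (N : ℕ) :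
    ∑ x ∈ box d (N + 1), f ‖x‖ = ∑ x ∈ box d N, f ‖x‖ + shellCard d N * f (N + 1) := by
  classical
  rw [← Finset.sum_sdiff (box_mono (d := d) (Nat.le_succ N)), add_comm]
  congr 1
  have h : ∀ x ∈ box d (N + 1) \ box d N, f ‖x‖ = f (N + 1) := by
    intro x hx
    rw [Finset.mem_sdiff, mem_box, mem_box] at hx
    obtain ⟨h1, h2⟩ := hx
    push Not at h2
    obtain ⟨i, hi⟩ := h2
    congr 1
    apply le_antisymm
    · have := mem_box_iff_norm.1 (mem_box.2 h1)
      exact_mod_cast this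
    · refine le_trans ?_ (norm_le_pi_norm x i)
      rw [Int.norm_eq_abs]
      exact_mod_cast hi
  rw [Finset.sum_congr rfl h, Finset.sum_const, Finset.card_sdiff_of_subset
    (box_mono (Nat.le_succ N)), card_box, card_box, nsmul_eq_mul, Nat.cast_sub
    (Nat.pow_le_pow_left (by omega) d), shellCard]
  push_cast
  ring

theorem sum_box (f : ℝ → ℝ) (h0 : f 0 = 0) (N : ℕ) :
    ∑ x ∈ box d N, f ‖x‖ = ∑ j ∈ Finset.range N, shellCard d j * f (j + 1) := by
  induction N with
  | zero =>
    rw [Finset.range_zero, Finset.sum_empty]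
    refine Finset.sum_eq_zero fun x hx => ?_
    have : ‖x‖ = 0 := le_antisymm (by simpa using mem_box_iff_norm.1 hx) (norm_nonneg _)
    rw [this, h0]
  | succ n ih => rw [sum_box_succ, ih, Finset.sum_range_succ]

theorem two_mul_pow_le_add_two_pow_sub {t : ℝ} (ht : 0 ≤ t) (e : ℕ) :
    2 * (t + 2) ^ e ≤ (t + 2) ^ (e + 1) - t ^ (e + 1) := by
  have : t ^ e ≤ (t + 2) ^ e := by gcongr; linarith
  rw [pow_succ, pow_succ]
  nlinarith

theorem add_two_pow_sub_le {t : ℝ} (ht : 0 ≤ t) (e : ℕ) :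
    (t + 2) ^ (e + 1) - t ^ (e + 1) ≤ 2 * (e + 1) * (t + 2) ^ e := by
  induction e with
  | zero => simp
  | succ e ih =>
    have h : t ^ (e + 1) ≤ (t + 2) ^ (e + 1) := by gcongr; linarith
    have e1 : (t + 2) ^ (e + 1 + 1) = (t + 2) * (t + 2) ^ (e + 1) := pow_succ' _ _
    have e2 : t ^ (e + 1 + 1) = t * t ^ (e + 1) := pow_succ' _ _
    have e3 : (t + 2) ^ (e + 1) = (t + 2) * (t + 2) ^ e := pow_succ' _ _
    have := mul_le_mul_of_nonneg_left ih (by linarith : 0 ≤ t)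
    have hp : 0 ≤ (t + 2) ^ e := by positivity
    push_cast
    nlinarith [mul_nonneg ht hp, mul_nonneg (Nat.cast_nonneg (α := ℝ) e) hp]

theorem pow_le_mul_shellCard (hd : 0 < d) (N : ℕ) :
    ((N : ℝ) + 1) ^ d ≤ (N + 1) * shellCard d N := by
  obtain ⟨e, rfl⟩ : ∃ e, d = e + 1 := ⟨d - 1, by omega⟩
  have hN : (0 : ℝ) ≤ N := Nat.cast_nonneg N
  have h := two_mul_pow_le_add_two_pow_sub (t := 2 * (N : ℝ) + 1) (by positivity) e
  have h2 : ((N : ℝ) + 1) ^ e ≤ (2 * (N : ℝ) + 1 + 2) ^ e :=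
    pow_le_pow_left₀ (by positivity) (by linarith) e
  have h3 : (0 : ℝ) ≤ ((N : ℝ) + 1) ^ e := by positivity
  rw [shellCard, pow_succ', show 2 * (N : ℝ) + 3 = 2 * N + 1 + 2 by ring]
  gcongr
  linarith

theorem mul_shellCard_le (hd : 0 < d) (N : ℕ) :
    ((N : ℝ) + 1) * shellCard d N ≤ d * 3 ^ d * ((N : ℝ) + 1) ^ d := by
  obtain ⟨e, rfl⟩ : ∃ e, d = e + 1 := ⟨d - 1, by omega⟩
  have hN : (0 : ℝ) ≤ N := Nat.cast_nonneg N
  have h := add_two_pow_sub_le (t := 2 * (N : ℝ) + 1) (by positivity) e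
  have h2 : (2 * (N : ℝ) + 1 + 2) ^ e ≤ (3 * ((N : ℝ) + 1)) ^ e :=
    pow_le_pow_left₀ (by positivity) (by linarith) e
  rw [shellCard, show 2 * (N : ℝ) + 3 = 2 * N + 1 + 2 by ring, pow_succ' ((N : ℝ) + 1),
    ← mul_assoc, mul_comm ((e + 1 : ℕ) * (3 : ℝ) ^ (e + 1)), mul_assoc]
  gcongr
  refine h.trans ?_
  rw [mul_pow] at h2
  push_cast
  have : (0 : ℝ) ≤ (e + 1) * (3 ^ e * ((N : ℝ) + 1) ^ e) := by positivity
  calc 2 * ((e : ℝ) + 1) * (2 * N + 1 + 2) ^ e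
      ≤ 2 * ((e : ℝ) + 1) * (3 ^ e * ((N : ℝ) + 1) ^ e) := by gcongr
    _ ≤ _ := by rw [pow_succ (3 : ℝ)]; nlinarith

variable {α : ℝ}

theorem sum_box_sq_mul_profile (L : ℝ) (N : ℕ) :
    ∑ x ∈ box d N, ‖x‖ ^ 2 * profile d α L ‖x‖ = ∑ j ∈ Finset.range N,
      (((j : ℝ) + 1) * shellCard d j) * (((j : ℝ) + 1) * profile d α L (j + 1)) := by
  rw [sum_box (fun s => s ^ 2 * profile d α L s) (by simp)]
  refine Finset.sum_congr rfl fun j _ => ?_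
  ring

theorem radial_le_sum_box (hd : 0 < d) {L : ℝ} (hL : 1 ≤ L) (N : ℕ) :
    radial d α L N ≤ ∑ x ∈ box d N, ‖x‖ ^ 2 * profile d α L ‖x‖ := by
  rw [sum_box_sq_mul_profile]
  refine Finset.sum_le_sum fun j _ => ?_
  have := profile_pos d α hL ((j : ℝ) + 1)
  rw [pow_succ, mul_assoc]
  gcongr
  exact pow_le_mul_shellCard hd j

theorem sum_box_le_radial (hd : 0 < d) {L : ℝ} (hL : 1 ≤ L) (N : ℕ) :
    ∑ x ∈ box d N, ‖x‖ ^ 2 * profile d α L ‖x‖ ≤ d * 3 ^ d * radial d α L N := by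
  rw [sum_box_sq_mul_profile, radial, Finset.mul_sum]
  refine Finset.sum_le_sum fun j _ => ?_
  have := profile_pos d α hL ((j : ℝ) + 1)
  have h := mul_le_mul_of_nonneg_right (mul_shellCard_le hd j)
    (by positivity : 0 ≤ ((j : ℝ) + 1) * profile d α L (j + 1))
  rwa [mul_assoc _ (((j : ℝ) + 1) ^ d), ← mul_assoc (((j : ℝ) + 1) ^ d), ← pow_succ] at h

/-- The second moment is shared equally among the coordinates. -/
theorem sum_box_sq_le_mul_sum_box_coord (i : Fin d) {f : ℝ → ℝ} (hf : ∀ s, 0 ≤ f s) (N : ℕ) :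
    ∑ x ∈ box d N, ‖x‖ ^ 2 * f ‖x‖ ≤ d * ∑ x ∈ box d N, (x i : ℝ) ^ 2 * f ‖x‖ := by
  have hperm : ∀ j : Fin d, ∑ x ∈ box d N, (x j : ℝ) ^ 2 * f ‖x‖ =
      ∑ x ∈ box d N, (x i : ℝ) ^ 2 * f ‖x‖ := by
    intro j
    have hnorm : ∀ x : Fin d → ℤ, ‖x ∘ Equiv.swap i j‖ = ‖x‖ := by
      intro x
      have h : ∀ x : Fin d → ℤ, ‖x ∘ Equiv.swap i j‖ ≤ ‖x‖ := fun x =>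
        (pi_norm_le_iff_of_nonneg (norm_nonneg _)).2 fun k => norm_le_pi_norm x _
      refine le_antisymm (h x) ?_
      have := h (x ∘ Equiv.swap i j)
      rwa [Function.comp_assoc, ← Equiv.coe_trans, Equiv.swap_swap, Equiv.coe_refl,
        Function.comp_id] at this
    have hinv : ∀ x : Fin d → ℤ, (x ∘ Equiv.swap i j) ∘ Equiv.swap i j = x := fun x => by
      rw [Function.comp_assoc, ← Equiv.coe_trans, Equiv.swap_swap, Equiv.coe_refl,
        Function.comp_id]
    refine Finset.sum_nbij' (fun x => x ∘ Equiv.swap i j) (fun x => x ∘ Equiv.swap i j) ?_ ?_ ?_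
      ?_ ?_
    · intro x hx; rw [mem_box_iff_norm] at *; rwa [hnorm]
    · intro x hx; rw [mem_box_iff_norm] at *; rwa [hnorm]
    · intro x _; exact hinv x
    · intro x _; exact hinv x
    · intro x _
      simp only [hnorm, Function.comp_apply, Equiv.swap_apply_left]
  calc ∑ x ∈ box d N, ‖x‖ ^ 2 * f ‖x‖
      ≤ ∑ x ∈ box d N, ∑ j, (x j : ℝ) ^ 2 * f ‖x‖ := by
        refine Finset.sum_le_sum fun x _ => ?_
        rw [← Finset.sum_mul]
        refine mul_le_mul_of_nonneg_right ?_ (hf _)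
        obtain ⟨j, hj⟩ := exists_norm_apply_eq i.pos x
        calc ‖x‖ ^ 2 = (x j : ℝ) ^ 2 := by rw [← hj, Int.norm_eq_abs, sq_abs]
          _ ≤ _ := Finset.single_le_sum (f := fun j => (x j : ℝ) ^ 2)
              (fun j _ => sq_nonneg _) (Finset.mem_univ j)
    _ = ∑ j : Fin d, ∑ x ∈ box d N, (x j : ℝ) ^ 2 * f ‖x‖ := Finset.sum_comm
    _ = d * ∑ x ∈ box d N, (x i : ℝ) ^ 2 * f ‖x‖ := by
        rw [Finset.sum_congr rfl fun j _ => hperm j]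
        simp

end Box

/-! ### The kernel: profile bounds, symmetry, second moments -/

section Kernel

variable {d : ℕ}

theorem norm_le_norm_toEuclid (x : Fin d → ℤ) : ‖x‖ ≤ ‖toEuclid x‖ := by
  rw [pi_norm_le_iff_of_nonneg (norm_nonneg _)]
  intro i
  have := PiLp.norm_apply_le (toEuclid x) i
  simpa [toEuclid, Int.norm_eq_abs] using this

theorem norm_toEuclid_le (x : Fin d → ℤ) : ‖toEuclid x‖ ≤ d * ‖x‖ := by
  rw [EuclideanSpace.norm_eq]
  apply Real.sqrt_le_iff.2
  refine ⟨by positivity, ?_⟩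
  have h : ∀ i, ‖toEuclid x i‖ ≤ ‖x‖ := fun i => by
    have := norm_le_pi_norm x i
    simpa [toEuclid, Int.norm_eq_abs] using this
  calc ∑ i, ‖toEuclid x i‖ ^ 2 ≤ ∑ _i : Fin d, ‖x‖ ^ 2 :=
        Finset.sum_le_sum fun i _ => pow_le_pow_left₀ (norm_nonneg _) (h i) 2
    _ = (d : ℝ) * ‖x‖ ^ 2 := by simp
    _ ≤ (d : ℝ) ^ 2 * ‖x‖ ^ 2 := by
        gcongr
        exact_mod_cast Nat.le_self_pow two_ne_zero d
    _ = (d * ‖x‖) ^ 2 := by ring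

theorem one_le_pi_div_two : 1 ≤ Real.pi / 2 := by linarith [Real.two_le_pi]

theorem max_le_tnorm {L : ℝ} (x : Fin d → ℤ) : max ‖x‖ L ≤ tnorm L (toEuclid x) := by
  have h1 : max ‖x‖ L ≤ max ‖toEuclid x‖ L := max_le_max_right _ (norm_le_norm_toEuclid x)
  have h2 : 0 ≤ max ‖toEuclid x‖ L := le_max_of_le_left (norm_nonneg _)
  unfold tnorm
  nlinarith [one_le_pi_div_two]

theorem tnorm_le_mul_max (hd : 0 < d) {L : ℝ} (hL : 1 ≤ L) (x : Fin d → ℤ) :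
    tnorm L (toEuclid x) ≤ (Real.pi / 2 * d) * max ‖x‖ L := by
  have hd1 : (1 : ℝ) ≤ d := by exact_mod_cast hd
  have hL0 : 0 < L := by linarith
  rw [tnorm, mul_assoc]
  gcongr
  refine max_le ((norm_toEuclid_le x).trans ?_) ?_
  · gcongr
    exact le_max_left _ _
  · nlinarith [le_max_right ‖x‖ L]

variable {α L Klb Kub Δ : ℝ} {P : (Fin d → ℤ) → ℝ}

namespace IsPowerLawKernel

theorem le_profile (hα : 0 < α) (hL : 1 ≤ L) (hKub : 0 < Kub)
    (hP : IsPowerLawKernel α L Klb Kub Δ P) (x : Fin d → ℤ) :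
    P x ≤ Kub * profile d α L ‖x‖ := by
  have hprof := profile_pos d α hL ‖x‖
  by_cases hx : x = 0
  · rw [hx, hP.zero]
    have := profile_pos d α hL ‖(0 : Fin d → ℤ)‖
    positivity
  · refine (hP.upper x hx).trans ?_
    have h0 : 0 < max ‖x‖ L := lt_max_of_lt_right (by linarith)
    rw [profile, ← mul_div_assoc]
    have := max_le_tnorm (L := L) x
    gcongr

theorem profile_le (hd : 0 < d) (hα : 0 < α) (hL : 1 ≤ L) (hKlb : 0 < Klb)
    (hP : IsPowerLawKernel α L Klb Kub Δ P) {x : Fin d → ℤ} (hx : x ≠ 0) :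
    Klb / (Real.pi / 2 * d) ^ ((d : ℝ) + α) * profile d α L ‖x‖ ≤ P x := by
  have hd0 : (0 : ℝ) < d := by exact_mod_cast hd
  refine le_trans (le_of_eq ?_) ((div_le_div_of_nonneg_left ?_ ?_
    (Real.rpow_le_rpow ?_ (tnorm_le_mul_max hd hL x) (by positivity))).trans (hP.lower x hx))
  · have h0 : 0 < max ‖x‖ L := lt_max_of_lt_right (by linarith)
    rw [Real.mul_rpow (by positivity) h0.le, profile]
    field_simp
  · positivity
  · have h0 : 0 < max ‖x‖ L := lt_max_of_lt_right (by linarith)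
    have := h0.trans_le (max_le_tnorm x)
    positivity
  · exact (lt_max_of_lt_right (by linarith : 0 < L)).le.trans (max_le_tnorm x)

theorem le_sup (hα : 0 < α) (hL : 1 ≤ L) (hKub : 0 < Kub)
    (hP : IsPowerLawKernel α L Klb Kub Δ P) (x : Fin d → ℤ) : P x ≤ Kub * L ^ (-(d : ℝ)) := by
  refine (hP.le_profile hα hL hKub x).trans ?_
  have hL0 : 0 < L := by linarith
  gcongr
  rw [profile]
  calc L ^ α / max ‖x‖ L ^ ((d : ℝ) + α) ≤ L ^ α / L ^ ((d : ℝ) + α) := by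
        gcongr
        exact le_max_right _ _
    _ = L ^ (-(d : ℝ)) := by
        rw [← Real.rpow_sub hL0]
        congr 1
        ring

end IsPowerLawKernel

/-- Reflection in the coordinate hyperplane `x i = 0`. -/
def reflect (i : Fin d) : (Fin d → ℤ) ≃ (Fin d → ℤ) :=
  Function.Involutive.toPerm (fun x => Function.update x i (-x i)) fun x => by simp

theorem reflect_apply (i : Fin d) (x : Fin d → ℤ) :
    reflect i x = Function.update x i (-x i) := rfl

theorem reflect_reflect (i : Fin d) (x : Fin d → ℤ) : reflect i (reflect i x) = x := by
  simp [reflect_apply]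

theorem norm_reflect (i : Fin d) (x : Fin d → ℤ) : ‖reflect i x‖ = ‖x‖ := by
  have h : ∀ x : Fin d → ℤ, ‖reflect i x‖ ≤ ‖x‖ := fun x =>
    (pi_norm_le_iff_of_nonneg (norm_nonneg _)).2 fun j => by
      rw [reflect_apply]
      by_cases hj : j = i
      · subst hj; simpa using norm_le_pi_norm x j
      · simpa [hj] using norm_le_pi_norm x j
  refine le_antisymm (h x) ?_
  simpa [reflect_reflect] using h (reflect i x)

theorem IsZdSymmetric.reflect (h : IsZdSymmetric P) (i : Fin d) (x : Fin d → ℤ) :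
    P (reflect i x) = P x := h.reflection i x

theorem IsZdSymmetric.neg (h : IsZdSymmetric P) (x : Fin d → ℤ) : P (-x) = P x := by
  classical
  have key : ∀ s : Finset (Fin d), P (fun j => if j ∈ s then -x j else x j) = P x := by
    intro s
    induction s using Finset.induction_on with
    | empty => simp
    | insert i s hi ih =>
      rw [← ih, ← h.reflection i (fun j => if j ∈ s then -x j else x j)]
      congr 1
      funext j
      by_cases hj : j = i
      · subst hj; simp [hi]
      · simp [hj]
  simpa [Pi.neg_def] using key Finset.univ

namespace IsPowerLawKernel

theorem exists_sum_box_le (hd : 0 < d) (hα : 0 < α) (hKub : 0 < Kub) :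
    ∃ C : ℝ, 0 < C ∧ ∀ L : ℝ, 1 ≤ L → ∀ (Klb Δ : ℝ) (P : (Fin d → ℤ) → ℝ),
      IsPowerLawKernel α L Klb Kub Δ P → ∀ ρ : ℝ, L ≤ ρ → ∀ N : ℕ, (N : ℝ) ≤ ρ →
      ∑ x ∈ box d N, P x * ‖x‖ ^ 2 ≤
        C * (L ^ 2 * (ρ / L) ^ (2 - min α 2) * slow α (ρ / L)) := by
  obtain ⟨C, hC, h⟩ := exists_radial_le d hα
  have hd0 : (0 : ℝ) < d := by exact_mod_cast hd
  refine ⟨Kub * (d * 3 ^ d) * C, by positivity, fun L hL Klb Δ P hP ρ hρ N hN => ?_⟩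
  calc ∑ x ∈ box d N, P x * ‖x‖ ^ 2
      ≤ ∑ x ∈ box d N, Kub * (‖x‖ ^ 2 * profile d α L ‖x‖) := by
        refine Finset.sum_le_sum fun x _ => ?_
        nlinarith [mul_le_mul_of_nonneg_right (hP.le_profile hα hL hKub x) (sq_nonneg ‖x‖)]
    _ ≤ Kub * ((d * 3 ^ d) *
          (C * (L ^ 2 * (ρ / L) ^ (2 - min α 2) * slow α (ρ / L)))) := by
        rw [← Finset.mul_sum]
        gcongr
        refine (sum_box_le_radial hd hL N).trans ?_
        gcongr
        exact h L ρ hL hρ N hN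
    _ = _ := by ring

theorem exists_le_sum_box_coord (hd : 0 < d) (hα : 0 < α) (hKlb : 0 < Klb) :
    ∃ c : ℝ, 0 < c ∧ ∀ L : ℝ, 1 ≤ L → ∀ (Kub Δ : ℝ) (P : (Fin d → ℤ) → ℝ),
      IsPowerLawKernel α L Klb Kub Δ P → ∀ ρ : ℝ, L ≤ ρ → ∀ i : Fin d,
      c * (L ^ 2 * (ρ / L) ^ (2 - min α 2) * slow α (ρ / L)) ≤
        ∑ x ∈ box d ⌊ρ⌋₊, P x * (x i : ℝ) ^ 2 := by
  obtain ⟨c, hc, h⟩ := exists_le_radial d hα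
  have hd0 : (0 : ℝ) < d := by exact_mod_cast hd
  set κ := Klb / (Real.pi / 2 * d) ^ ((d : ℝ) + α) with hκ
  have hκ0 : 0 < κ := by positivity
  refine ⟨κ / d * c, by positivity, fun L hL Kub Δ P hP ρ hρ i => ?_⟩
  calc κ / d * c * (L ^ 2 * (ρ / L) ^ (2 - min α 2) * slow α (ρ / L))
      = κ / d * (c * (L ^ 2 * (ρ / L) ^ (2 - min α 2) * slow α (ρ / L))) := by ring
    _ ≤ κ / d * (d * ∑ x ∈ box d ⌊ρ⌋₊, (x i : ℝ) ^ 2 * profile d α L ‖x‖) := by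
        refine mul_le_mul_of_nonneg_left ?_ (by positivity)
        exact (h L ρ hL hρ).trans ((radial_le_sum_box hd hL _).trans
          (sum_box_sq_le_mul_sum_box_coord i (fun s => (profile_pos d α hL s).le) _))
    _ = ∑ x ∈ box d ⌊ρ⌋₊, κ * profile d α L ‖x‖ * (x i : ℝ) ^ 2 := by
        rw [← mul_assoc, div_mul_cancel₀ _ hd0.ne', Finset.mul_sum]
        exact Finset.sum_congr rfl fun x _ => by ring
    _ ≤ _ := by
        refine Finset.sum_le_sum fun x _ => ?_
        by_cases hx : x = 0
        · simp [hx]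
        · exact mul_le_mul_of_nonneg_right (hP.profile_le hd hα hL hKlb hx) (sq_nonneg _)

end IsPowerLawKernel

/-! ### The Fourier transform near the origin -/

/-- The pairing `k · x`. -/
def dot (k : Fin d → ℝ) (x : Fin d → ℤ) : ℝ := ∑ i, k i * (x i : ℝ)

/-- The Fourier transform of an even law is the cosine series. -/
def charFn (P : (Fin d → ℤ) → ℝ) (k : Fin d → ℝ) : ℝ := ∑' x, P x * Real.cos (dot k x)

theorem dot_reflect (k : Fin d → ℝ) (i : Fin d) (x : Fin d → ℤ) :
    dot k (reflect i x) = dot k x - 2 * (k i * x i) := by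
  have h : ∀ y : Fin d → ℤ, dot k y = k i * y i + ∑ j ∈ Finset.univ.erase i, k j * (y j : ℝ) :=
    fun y => (Finset.add_sum_erase _ _ (Finset.mem_univ i)).symm
  have h2 : ∑ j ∈ Finset.univ.erase i, k j * (reflect i x j : ℝ) =
      ∑ j ∈ Finset.univ.erase i, k j * (x j : ℝ) := by
    refine Finset.sum_congr rfl fun j hj => ?_
    rw [reflect_apply, Function.update_of_ne (Finset.ne_of_mem_erase hj)]
  rw [h, h x, h2, reflect_apply, Function.update_self]
  push_cast
  ring

theorem dot_sub (k : Fin d → ℝ) (x y : Fin d → ℤ) : dot k (x - y) = dot k x - dot k y := by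
  simp [dot, mul_sub, Finset.sum_sub_distrib]

theorem dot_neg (k : Fin d → ℝ) (x : Fin d → ℤ) : dot k (-x) = -dot k x := by
  simp [dot]

namespace IsPowerLawKernel

theorem summable_mul_of_abs_le (hP : IsPowerLawKernel α L Klb Kub Δ P) {f : (Fin d → ℤ) → ℝ}
    (hf : ∀ x, |f x| ≤ 1) :
    Summable fun x => P x * f x := by
  refine Summable.of_norm_bounded hP.hasSum_one.summable fun x => ?_
  rw [norm_mul, Real.norm_eq_abs, Real.norm_eq_abs, abs_of_nonneg (hP.nonneg x)]
  exact mul_le_of_le_one_right (hP.nonneg x) (hf x)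

theorem hasSum_charFn (hP : IsPowerLawKernel α L Klb Kub Δ P) (k : Fin d → ℝ) :
    HasSum (fun x => P x * Real.cos (dot k x)) (charFn P k) :=
  (hP.summable_mul_of_abs_le fun _ => Real.abs_cos_le_one _).hasSum

theorem fourier_re (hP : IsPowerLawKernel α L Klb Kub Δ P) (k : Fin d → ℝ) :
    (fourier P k).re = charFn P k := by
  rw [fourier, charFn, Complex.re_tsum]
  · refine tsum_congr fun x => ?_
    rw [Complex.re_ofReal_mul, mul_comm Complex.I, Complex.exp_ofReal_mul_I_re]
    rfl
  · refine Summable.of_norm_bounded hP.hasSum_one.summable fun x => ?_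
    rw [norm_mul, mul_comm Complex.I, Complex.norm_exp_ofReal_mul_I, mul_one, Complex.norm_real,
      Real.norm_eq_abs, abs_of_nonneg (hP.nonneg x)]

theorem abs_charFn_le_one (hP : IsPowerLawKernel α L Klb Kub Δ P) (k : Fin d → ℝ) :
    |charFn P k| ≤ 1 := by
  rw [abs_le]
  constructor
  · refine hasSum_le (fun x => ?_) hP.hasSum_one.neg (hP.hasSum_charFn k)
    nlinarith [hP.nonneg x, Real.neg_one_le_cos (dot k x)]
  · refine hasSum_le (fun x => ?_) (hP.hasSum_charFn k) hP.hasSum_one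
    nlinarith [hP.nonneg x, Real.cos_le_one (dot k x)]

/-- Averaging over the reflection `x i ↦ -x i` turns `1 - cos (k · x)` into a quantity that is at
least `1 - cos (k i * x i)`, whatever the other coordinates are. -/
theorem sum_box_le_one_sub_charFn (hP : IsPowerLawKernel α L Klb Kub Δ P) {k : Fin d → ℝ}
    {i : Fin d} {N : ℕ} (hN : |k i| * N ≤ 1) :
    2 / Real.pi ^ 2 * k i ^ 2 * ∑ x ∈ box d N, P x * (x i : ℝ) ^ 2 ≤ 1 - charFn P k := by
  have h1 : HasSum (fun x => P x * (1 - Real.cos (dot k x))) (1 - charFn P k) := by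
    simpa [mul_sub] using hP.hasSum_one.sub (hP.hasSum_charFn k)
  have h2 : HasSum (fun x => P x * (1 - Real.cos (dot k x - 2 * (k i * x i))))
      (1 - charFn P k) := by
    refine ((reflect i).hasSum_iff.2 h1).congr_fun fun x => ?_
    simp only [Function.comp_apply, hP.symmetric.reflect, dot_reflect]
  have h3 := (h1.add h2).mul_left (1 / 2)
  rw [Finset.mul_sum]
  have key : ∀ x, 0 ≤ 1 / 2 * (P x * (1 - Real.cos (dot k x)) +
      P x * (1 - Real.cos (dot k x - 2 * (k i * x i)))) := fun x => by
    have := hP.nonneg x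
    have h4 := Real.cos_le_one (dot k x)
    have h5 := Real.cos_le_one (dot k x - 2 * (k i * x i))
    have h6 := mul_nonneg this (sub_nonneg.2 h4)
    have h7 := mul_nonneg this (sub_nonneg.2 h5)
    linarith
  rw [show 1 - charFn P k = 1 / 2 * (1 - charFn P k + (1 - charFn P k)) by ring]
  refine le_trans (Finset.sum_le_sum fun x hx => ?_)
    (sum_le_hasSum (box d N) (fun x _ => key x) h3)
  have hB : |k i * x i| ≤ 1 := by
    rw [abs_mul]
    refine le_trans (mul_le_mul_of_nonneg_left ?_ (abs_nonneg _)) hN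
    exact_mod_cast mem_box.1 hx i
  set B := k i * (x i : ℝ) with hBdef
  set A := dot k x - B
  have e1 : dot k x = A + B := by ring
  have e2 : dot k x - 2 * B = A - B := by ring
  have c1 : Real.cos (dot k x) = Real.cos A * Real.cos B - Real.sin A * Real.sin B := by
    rw [← Real.cos_add, ← e1]
  have c2 : Real.cos (dot k x - 2 * B) = Real.cos A * Real.cos B + Real.sin A * Real.sin B := by
    rw [← Real.cos_sub, ← e2]
  rw [c1, c2]
  have hcos0 : 0 ≤ Real.cos B := (Real.cos_pos_of_le_one hB).le
  have hcos1 : Real.cos B ≤ 1 - 2 / Real.pi ^ 2 * B ^ 2 :=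
    Real.cos_le_one_sub_mul_cos_sq (hB.trans (by linarith [Real.pi_gt_three]))
  have hA := mul_le_mul_of_nonneg_right (Real.cos_le_one A) hcos0
  calc 2 / Real.pi ^ 2 * k i ^ 2 * (P x * (x i : ℝ) ^ 2)
      = P x * (2 / Real.pi ^ 2 * B ^ 2) := by rw [hBdef]; ring
    _ ≤ P x * (1 - Real.cos A * Real.cos B) :=
        mul_le_mul_of_nonneg_left (by linarith) (hP.nonneg x)
    _ = _ := by ring

theorem exists_le_one_sub_charFn (hd : 0 < d) (hα : 0 < α) (hKlb : 0 < Klb) :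
    ∃ c : ℝ, 0 < c ∧ ∀ L : ℝ, 1 ≤ L → ∀ (Kub Δ : ℝ) (P : (Fin d → ℤ) → ℝ),
      IsPowerLawKernel α L Klb Kub Δ P → ∀ k : Fin d → ℝ, k ≠ 0 → ‖k‖ ≤ L⁻¹ →
      c * ((L * ‖k‖) ^ (min α 2) * slow α (L * ‖k‖)⁻¹) ≤ 1 - charFn P k := by
  obtain ⟨c, hc, h⟩ := exists_le_sum_box_coord (d := d) hd hα hKlb
  refine ⟨2 / Real.pi ^ 2 * c, by positivity, fun L hL Kub Δ P hP k hk hkL => ?_⟩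
  have hL0 : 0 < L := by linarith
  have hk0 : 0 < ‖k‖ := norm_pos_iff.2 hk
  obtain ⟨i, hi⟩ := exists_norm_apply_eq hd k
  rw [Real.norm_eq_abs] at hi
  have hρ : L ≤ ‖k‖⁻¹ := (le_inv_comm₀ hk0 hL0).1 hkL
  have hN : |k i| * (⌊‖k‖⁻¹⌋₊ : ℝ) ≤ 1 := by
    rw [hi]
    refine (mul_le_mul_of_nonneg_left (Nat.floor_le (by positivity)) hk0.le).trans ?_
    rw [mul_inv_cancel₀ hk0.ne']
  refine le_trans ?_ (hP.sum_box_le_one_sub_charFn hN)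
  refine le_trans (le_of_eq ?_) (mul_le_mul_of_nonneg_left (h L hL Kub Δ P hP _ hρ i)
    (by positivity))
  have e1 : ‖k‖⁻¹ / L = (L * ‖k‖)⁻¹ := by rw [mul_inv, mul_comm, div_eq_mul_inv, mul_comm]
  have ht : 0 < L * ‖k‖ := by positivity
  have e2 : k i ^ 2 = ‖k‖ ^ 2 := by rw [← hi, sq_abs]
  rw [e1, e2, Real.inv_rpow ht.le, ← Real.rpow_neg ht.le, neg_sub, Real.rpow_sub ht,
    Real.rpow_two]
  field_simp

end IsPowerLawKernel

end Kernel

/-! ### Fourier inversion for the walk -/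

section Inversion

open MeasureTheory

variable {d : ℕ} {α L Klb Kub Δ : ℝ} {P : (Fin d → ℤ) → ℝ}

/-- The fundamental cell `(-π, π]^d`. -/
def cell (d : ℕ) : Set (Fin d → ℝ) := Set.univ.pi fun _ => Set.Ioc (-Real.pi) Real.pi

theorem mem_cell {k : Fin d → ℝ} : k ∈ cell d ↔ ∀ i, k i ∈ Set.Ioc (-Real.pi) Real.pi := by
  simp [cell]

theorem measurableSet_cell : MeasurableSet (cell d) :=
  MeasurableSet.univ_pi fun _ => measurableSet_Ioc

theorem volume_cell_lt_top : volume (cell d) < ∞ := by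
  rw [cell, volume_pi_pi]
  exact ENNReal.prod_lt_top fun i _ => by simp

instance : IsFiniteMeasure ((volume : Measure (Fin d → ℝ)).restrict (cell d)) :=
  ⟨by simpa using volume_cell_lt_top⟩

theorem continuous_dot (x : Fin d → ℤ) : Continuous fun k => dot k x := by
  unfold dot
  fun_prop

theorem integral_exp_int (n : ℤ) :
    ∫ t in Set.Ioc (-Real.pi) Real.pi, Complex.exp (((t * n : ℝ) : ℂ) * Complex.I) =
      if n = 0 then 2 * (Real.pi : ℂ) else 0 := by
  rw [← intervalIntegral.integral_of_le (by linarith [Real.pi_pos])]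
  split_ifs with hn
  · subst hn
    simp
    ring
  · have hc : ((n : ℂ) * Complex.I) ≠ 0 := by simp [hn]
    have h := integral_exp_mul_complex (a := -Real.pi) (b := Real.pi) hc
    rw [show (fun t : ℝ => Complex.exp (((t * n : ℝ) : ℂ) * Complex.I)) =
      fun t : ℝ => Complex.exp ((n : ℂ) * Complex.I * t) from funext fun t => by
        congr 1; push_cast; ring, h]
    have e : Complex.exp ((n : ℂ) * Complex.I * Real.pi) =
        Complex.exp ((n : ℂ) * Complex.I * ((-Real.pi : ℝ) : ℂ)) := by
      rw [Complex.exp_eq_exp_iff_exists_int]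
      exact ⟨n, by push_cast; ring⟩
    rw [e, sub_self, zero_div]

theorem integral_cos_dot (x : Fin d → ℤ) :
    ∫ k in cell d, Real.cos (dot k x) = if x = 0 then (2 * Real.pi) ^ d else 0 := by
  have h1 : ∫ k in cell d, Complex.exp ((dot k x : ℂ) * Complex.I) =
      ∏ i, ∫ t in Set.Ioc (-Real.pi) Real.pi, Complex.exp (((t * x i : ℝ) : ℂ) * Complex.I) := by
    rw [cell, volume_pi, Measure.restrict_pi_pi, ← integral_fintype_prod_eq_prod]
    refine integral_congr_ae (Filter.Eventually.of_forall fun k => ?_)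
    simp only [dot]
    rw [← Complex.exp_sum, ← Finset.sum_mul]
    push_cast
    rfl
  have hint : IntegrableOn (fun k => Complex.exp ((dot k x : ℂ) * Complex.I)) (cell d) := by
    refine Integrable.of_bound (C := 1) ?_ ?_
    · have := continuous_dot x
      exact (by fun_prop : Continuous fun k => Complex.exp ((dot k x : ℂ) *
        Complex.I)).aestronglyMeasurable
    · exact Filter.Eventually.of_forall fun k => by rw [Complex.norm_exp_ofReal_mul_I]
  have h2 : ∫ k in cell d, Real.cos (dot k x) =
      (∫ k in cell d, Complex.exp ((dot k x : ℂ) * Complex.I)).re := by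
    have := integral_re hint
    simp only [RCLike.re_to_complex] at this
    rw [← this]
    refine integral_congr_ae (Filter.Eventually.of_forall fun k => ?_)
    simp only [Complex.exp_ofReal_mul_I_re]
  rw [h2, h1]
  simp_rw [integral_exp_int]
  split_ifs with hx
  · subst hx
    simp only [Pi.zero_apply, if_true, Finset.prod_const, Finset.card_univ, Fintype.card_fin]
    exact_mod_cast Complex.ofReal_re ((2 * Real.pi) ^ d)
  · obtain ⟨i, hi⟩ : ∃ i, x i ≠ 0 := by
      by_contra! h
      exact hx (funext h)
    rw [Finset.prod_eq_zero (Finset.mem_univ i) (by rw [if_neg hi])]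
    rfl

/-- The Fourier integral for the `n`-step transition probability. -/
def inversion (P : (Fin d → ℤ) → ℝ) (n : ℕ) (x : Fin d → ℤ) : ℝ :=
  ((2 * Real.pi) ^ d)⁻¹ * ∫ k in cell d, charFn P k ^ n * Real.cos (dot k x)

namespace IsPowerLawKernel

theorem continuous_charFn (hP : IsPowerLawKernel α L Klb Kub Δ P) :
    Continuous (charFn P) := by
  refine continuous_tsum (fun x => ?_) hP.hasSum_one.summable fun x k => ?_
  · have := continuous_dot x
    fun_prop
  · rw [norm_mul, Real.norm_eq_abs, Real.norm_eq_abs, abs_of_nonneg (hP.nonneg x)]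
    exact mul_le_of_le_one_right (hP.nonneg x) (Real.abs_cos_le_one _)

theorem hasSum_cos_dot_sub (hP : IsPowerLawKernel α L Klb Kub Δ P) (k : Fin d → ℝ)
    (x : Fin d → ℤ) :
    HasSum (fun y => P y * Real.cos (dot k (x - y))) (charFn P k * Real.cos (dot k x)) := by
  have hsin : HasSum (fun y => P y * Real.sin (dot k y)) 0 := by
    have h := (hP.summable_mul_of_abs_le (f := fun y => Real.sin (dot k y))
      fun _ => Real.abs_sin_le_one _).hasSum
    have h' := ((Equiv.neg (Fin d → ℤ)).hasSum_iff.2 h)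
    have h2 : HasSum (fun y => -(P y * Real.sin (dot k y)))
        (∑' y, P y * Real.sin (dot k y)) := by
      refine h'.congr_fun fun y => ?_
      simp [hP.symmetric.neg, dot_neg]
    have := h2.unique h.neg
    have h0 : ∑' y, P y * Real.sin (dot k y) = 0 := by linarith
    rwa [h0] at h
  have h := ((hP.hasSum_charFn k).mul_right (Real.cos (dot k x))).add
    (hsin.mul_right (Real.sin (dot k x)))
  rw [zero_mul, add_zero] at h
  refine h.congr_fun fun y => ?_
  rw [dot_sub, Real.cos_sub]
  ring

theorem abs_charFn_pow_mul_le_one (hP : IsPowerLawKernel α L Klb Kub Δ P) (n : ℕ)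
    (k : Fin d → ℝ) (x : Fin d → ℤ) : |charFn P k ^ n * Real.cos (dot k x)| ≤ 1 := by
  rw [abs_mul, abs_pow]
  exact mul_le_one₀ (pow_le_one₀ (abs_nonneg _) (hP.abs_charFn_le_one k)) (abs_nonneg _)
    (Real.abs_cos_le_one _)

theorem hasSum_inversion_succ (hP : IsPowerLawKernel α L Klb Kub Δ P) (n : ℕ)
    (x : Fin d → ℤ) :
    HasSum (fun y => P y * inversion P n (x - y)) (inversion P (n + 1) x) := by
  have hcont := hP.continuous_charFn
  have h : HasSum
      (fun y => ∫ k in cell d, P y * (charFn P k ^ n * Real.cos (dot k (x - y))))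
      (∫ k in cell d, charFn P k ^ (n + 1) * Real.cos (dot k x)) := by
    refine hasSum_integral_of_dominated_convergence (fun y _ => P y) (fun y => ?_) (fun y => ?_)
      ?_ ?_ ?_
    · have := continuous_dot (x - y)
      exact (by fun_prop : Continuous fun k =>
        P y * (charFn P k ^ n * Real.cos (dot k (x - y)))).aestronglyMeasurable
    · refine Filter.Eventually.of_forall fun k => ?_
      rw [norm_mul, Real.norm_eq_abs, Real.norm_eq_abs, abs_of_nonneg (hP.nonneg y)]
      exact mul_le_of_le_one_right (hP.nonneg y) (hP.abs_charFn_pow_mul_le_one n k _)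
    · exact Filter.Eventually.of_forall fun _ => hP.hasSum_one.summable
    · exact integrable_const _
    · refine Filter.Eventually.of_forall fun k => ?_
      have := (hP.hasSum_cos_dot_sub k x).mul_left (charFn P k ^ n)
      rw [← mul_assoc, ← pow_succ] at this
      refine this.congr_fun fun y => ?_
      ring
  refine (h.mul_left ((2 * Real.pi) ^ d)⁻¹).congr_fun fun y => ?_
  rw [integral_const_mul, inversion]
  ring

/-- Fourier inversion: the walk's transition probabilities are the Fourier integrals. -/
theorem inversion_nonneg_and_walk_eq (hP : IsPowerLawKernel α L Klb Kub Δ P) (n : ℕ)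
    (x : Fin d → ℤ) : 0 ≤ inversion P n x ∧
      walk (fun y => ENNReal.ofReal (P y)) n x = ENNReal.ofReal (inversion P n x) := by
  induction n generalizing x with
  | zero =>
    have h : inversion P 0 x = if x = 0 then 1 else 0 := by
      simp only [inversion, pow_zero, one_mul, integral_cos_dot]
      split_ifs
      · exact inv_mul_cancel₀ (by positivity)
      · simp
    rw [h]
    by_cases hx : x = 0
    · subst hx; simp [walk_zero_zero]
    · simp [walk_zero_of_ne _ hx, hx]
  | succ n ih =>
    have hs := hP.hasSum_inversion_succ n x
    have h0 : ∀ y, 0 ≤ P y * inversion P n (x - y) := fun y =>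
      mul_nonneg (hP.nonneg y) (ih _).1
    refine ⟨hs.nonneg h0, ?_⟩
    rw [walk_succ', ← hs.tsum_eq, ENNReal.ofReal_tsum_of_nonneg h0 hs.summable]
    refine tsum_congr fun y => ?_
    rw [(ih _).2, ENNReal.ofReal_mul (hP.nonneg y)]

theorem walk_le_integral (hP : IsPowerLawKernel α L Klb Kub Δ P) (n : ℕ) (x : Fin d → ℤ) :
    walk (fun y => ENNReal.ofReal (P y)) n x ≤
      ENNReal.ofReal (((2 * Real.pi) ^ d)⁻¹ * ∫ k in cell d, |charFn P k| ^ n) := by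
  rw [(hP.inversion_nonneg_and_walk_eq n x).2]
  have hcont := hP.continuous_charFn
  have hdot := continuous_dot x
  refine ENNReal.ofReal_le_ofReal (mul_le_mul_of_nonneg_left ?_ (by positivity))
  refine integral_mono ?_ ?_ fun k => ?_
  · exact Integrable.of_bound (C := 1) (by fun_prop : Continuous fun k =>
      charFn P k ^ n * Real.cos (dot k x)).aestronglyMeasurable
      (Filter.Eventually.of_forall fun k => hP.abs_charFn_pow_mul_le_one n k x)
  · exact Integrable.of_bound (C := 1) (by fun_prop : Continuous fun k =>
      |charFn P k| ^ n).aestronglyMeasurable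
      (Filter.Eventually.of_forall fun k => by
        rw [norm_pow, Real.norm_eq_abs, abs_abs]
        exact pow_le_one₀ (abs_nonneg _) (hP.abs_charFn_le_one k))
  · simp only
    refine (le_abs_self _).trans ?_
    rw [abs_mul, abs_pow]
    exact mul_le_of_le_one_right (by positivity) (Real.abs_cos_le_one _)

/-- Parseval for the one-step law: the mass of two steps at the origin is at most `sup P`. -/
theorem integral_charFn_sq_le (hα : 0 < α) (hL : 1 ≤ L) (hKub : 0 < Kub)
    (hP : IsPowerLawKernel α L Klb Kub Δ P) :
    ∫ k in cell d, charFn P k ^ 2 ≤ (2 * Real.pi) ^ d * (Kub * L ^ (-(d : ℝ))) := by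
  have hL0 : 0 < L := by linarith
  have h1 : walk (fun y => ENNReal.ofReal (P y)) 2 0 ≤ ENNReal.ofReal (Kub * L ^ (-(d : ℝ))) := by
    rw [walk_succ']
    calc ∑' y, ENNReal.ofReal (P y) * walk (fun y => ENNReal.ofReal (P y)) 1 (0 - y)
        ≤ ∑' y, ENNReal.ofReal (P y) * ENNReal.ofReal (Kub * L ^ (-(d : ℝ))) := by
          refine ENNReal.tsum_le_tsum fun y => ?_
          rw [walk_one]
          gcongr
          exact hP.le_sup hα hL hKub _
      _ = ENNReal.ofReal (Kub * L ^ (-(d : ℝ))) := by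
          rw [ENNReal.tsum_mul_right, ← ENNReal.ofReal_tsum_of_nonneg hP.nonneg
            hP.hasSum_one.summable, hP.hasSum_one.tsum_eq, ENNReal.ofReal_one, one_mul]
  rw [(hP.inversion_nonneg_and_walk_eq 2 0).2,
    ENNReal.ofReal_le_ofReal_iff (by positivity), inversion, inv_mul_le_iff₀ (by positivity)] at h1
  simpa [dot] using h1

end IsPowerLawKernel

end Inversion

/-! ### The uniform bound on transition probabilities -/

section OnDiagonal

open MeasureTheory

variable {d : ℕ} {α L Klb Kub Δ : ℝ} {P : (Fin d → ℤ) → ℝ}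

/-- The logarithmic correction, as a function of the number of steps. -/
def timeLog (α n : ℝ) : ℝ := if α = 2 then Real.log (1 + n) else 1

theorem timeLog_pos (α : ℝ) {n : ℝ} (hn : 1 ≤ n) : 0 < timeLog α n := by
  unfold timeLog
  split_ifs
  · exact Real.log_pos (by linarith)
  · exact one_pos

theorem timeLog_le (α : ℝ) {n : ℝ} (hn : 1 ≤ n) : timeLog α n ≤ n := by
  unfold timeLog
  split_ifs
  · linarith [Real.log_le_sub_one_of_pos (by linarith : 0 < 1 + n)]
  · exact hn

theorem exists_exp_neg_sqrt_le (α : ℝ) {b s : ℝ} (hb : 0 < b) (hs : 0 < s) :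
    ∃ C : ℝ, 0 < C ∧ ∀ n : ℝ, 1 ≤ n →
      Real.exp (-(b * √n)) ≤ C * (n * timeLog α n) ^ (-s) := by
  obtain ⟨m, hm⟩ := exists_nat_ge (4 * s)
  refine ⟨m.factorial / b ^ m, by positivity, fun n hn => ?_⟩
  have hn0 : 0 < n := by linarith
  have hlog := timeLog_pos α hn
  have h1 := Real.pow_div_factorial_le_exp (b * √n) (by positivity) m
  have h2 : n ^ (2 * s) ≤ √n ^ m := by
    rw [Real.sqrt_eq_rpow, ← Real.rpow_natCast, ← Real.rpow_mul hn0.le]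
    exact Real.rpow_le_rpow_of_exponent_le hn (by linarith)
  have h3 : (n * timeLog α n) ^ s ≤ n ^ (2 * s) := by
    rw [Real.rpow_mul hn0.le, Real.rpow_two]
    refine Real.rpow_le_rpow (by positivity) ?_ hs.le
    nlinarith [timeLog_le α hn]
  have h4 := h3.trans h2
  rw [Real.exp_neg, Real.rpow_neg (by positivity), ← div_eq_mul_inv, div_div,
    inv_le_comm₀ (Real.exp_pos _) (by positivity), inv_div]
  refine le_trans ?_ h1
  rw [mul_pow]
  gcongr

theorem integrable_exp_neg_norm_rpow (d : ℕ) {a : ℝ} (ha : 0 < a) :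
    Integrable fun u : Fin d → ℝ => Real.exp (-‖u‖ ^ a) := by
  obtain ⟨m, hm⟩ := exists_nat_ge (((d : ℝ) + 1) / a)
  have hma : (d : ℝ) + 1 ≤ a * m := by
    rw [div_le_iff₀ ha] at hm
    linarith
  have hdom : Integrable fun u : Fin d → ℝ =>
      (m.factorial : ℝ) * 2 ^ ((d : ℝ) + 1) * (1 + ‖u‖) ^ (-((d : ℝ) + 1)) := by
    refine Integrable.const_mul ?_ _
    exact integrable_one_add_norm (by simp)
  refine hdom.mono' ?_ (Filter.Eventually.of_forall fun u => ?_)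
  · have h : Continuous fun u : Fin d → ℝ => ‖u‖ ^ a :=
      continuous_norm.rpow_const fun _ => Or.inr ha.le
    exact (by fun_prop : Continuous fun u : Fin d → ℝ =>
      Real.exp (-‖u‖ ^ a)).aestronglyMeasurable
  · have hu : 0 ≤ ‖u‖ := norm_nonneg u
    have hf : (1 : ℝ) ≤ m.factorial := by exact_mod_cast m.factorial_pos
    rw [Real.norm_eq_abs, abs_of_pos (Real.exp_pos _), Real.rpow_neg (by positivity),
      ← div_eq_mul_inv, le_div_iff₀ (by positivity)]
    rcases le_total ‖u‖ 1 with h | h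
    · have h1 : Real.exp (-‖u‖ ^ a) ≤ 1 := Real.exp_le_one_iff.2 (by
        have := Real.rpow_nonneg hu a
        linarith)
      have h2 : (1 + ‖u‖) ^ ((d : ℝ) + 1) ≤ 2 ^ ((d : ℝ) + 1) := by
        gcongr
        linarith
      calc _ ≤ 1 * 2 ^ ((d : ℝ) + 1) := mul_le_mul h1 h2 (by positivity) zero_le_one
        _ ≤ _ := by gcongr
    · have h0 : 0 < ‖u‖ := by linarith
      have h1 := Real.pow_div_factorial_le_exp (‖u‖ ^ a) (by positivity) m
      have h2 : ‖u‖ ^ ((d : ℝ) + 1) ≤ (‖u‖ ^ a) ^ m := by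
        rw [← Real.rpow_natCast, ← Real.rpow_mul hu]
        exact Real.rpow_le_rpow_of_exponent_le h hma
      have h3 : (1 + ‖u‖) ^ ((d : ℝ) + 1) ≤ 2 ^ ((d : ℝ) + 1) * ‖u‖ ^ ((d : ℝ) + 1) := by
        rw [← Real.mul_rpow (by norm_num) hu]
        gcongr
        linarith
      rw [Real.exp_neg, inv_mul_le_iff₀ (Real.exp_pos _)]
      rw [div_le_iff₀ (by positivity)] at h1
      calc _ ≤ 2 ^ ((d : ℝ) + 1) * ‖u‖ ^ ((d : ℝ) + 1) := h3
        _ ≤ 2 ^ ((d : ℝ) + 1) * (Real.exp (‖u‖ ^ a) * m.factorial) := by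
          gcongr
          exact h2.trans h1
        _ = _ := by ring

theorem exp_neg_mul_norm_rpow_eq {a : ℝ} (ha : 0 < a) {T : ℝ} (hT : 0 < T) (k : Fin d → ℝ)
    (hL : 0 < L) :
    Real.exp (-(T * (L * ‖k‖) ^ a)) = Real.exp (-‖(L * T ^ a⁻¹) • k‖ ^ a) := by
  congr 2
  rw [norm_smul, Real.norm_eq_abs, abs_of_pos (by positivity),
    Real.mul_rpow (x := L * T ^ a⁻¹) (by positivity) (norm_nonneg k),
    Real.mul_rpow (x := L) (y := T ^ a⁻¹) hL.le (by positivity), ← Real.rpow_mul hT.le,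
    inv_mul_cancel₀ ha.ne', Real.rpow_one, Real.mul_rpow hL.le (norm_nonneg k)]
  ring

theorem integral_exp_neg_mul_norm_rpow {a : ℝ} (ha : 0 < a) {T : ℝ} (hT : 0 < T) (hL : 0 < L) :
    ∫ k : Fin d → ℝ, Real.exp (-(T * (L * ‖k‖) ^ a)) =
      L ^ (-(d : ℝ)) * T ^ (-((d : ℝ) / a)) * ∫ u : Fin d → ℝ, Real.exp (-‖u‖ ^ a) := by
  simp_rw [exp_neg_mul_norm_rpow_eq ha hT _ hL]
  rw [Measure.integral_comp_smul volume (fun u : Fin d → ℝ => Real.exp (-‖u‖ ^ a)),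
    abs_of_pos (by positivity), smul_eq_mul]
  congr 1
  rw [Module.finrank_fin_fun, ← Real.rpow_natCast, Real.mul_rpow hL.le (by positivity), mul_inv,
    ← Real.rpow_mul hT.le, ← Real.rpow_neg hL.le, ← Real.rpow_neg hT.le]
  congr 2
  ring

/-- At the critical exponent the frequencies `t ≤ n ^ (-1 / 4)` see a logarithm comparable to
`log n`, and the larger ones are suppressed by `exp (-c * √n)`. -/
theorem exp_neg_slow_le {c t n : ℝ} (hc : 0 < c) (ht : 0 < t) (ht1 : t ≤ 1) (hn : 1 ≤ n) :
    Real.exp (-(n * (c * (t ^ (min α 2) * slow α t⁻¹)))) ≤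
      Real.exp (-(c / 4 * (n * timeLog α n) * t ^ (min α 2))) + Real.exp (-(c * √n)) := by
  have hn0 : 0 < n := by linarith
  have hta : 0 < t ^ (min α 2) := by positivity
  by_cases hα : α = 2
  · subst hα
    rw [min_self, Real.rpow_two, slow, timeLog, if_pos rfl, if_pos rfl]
    have hlt : 0 ≤ Real.log t⁻¹ := Real.log_nonneg ((one_le_inv₀ ht).2 ht1)
    rcases le_total (Real.log n) (4 * Real.log t⁻¹) with h | h
    · have h1 : Real.log (1 + n) ≤ 4 * (1 + Real.log t⁻¹) := by
        have : Real.log (1 + n) ≤ Real.log (2 * n) :=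
          Real.log_le_log (by linarith) (by linarith)
        rw [Real.log_mul two_ne_zero hn0.ne'] at this
        linarith [Real.log_two_lt_d9]
      refine le_trans (Real.exp_le_exp.2 (neg_le_neg ?_)) (le_add_of_nonneg_right
        (Real.exp_pos _).le)
      have : 0 ≤ c / 4 * n * t ^ 2 := by positivity
      nlinarith [mul_le_mul_of_nonneg_left h1 this]
    · refine le_trans (Real.exp_le_exp.2 (neg_le_neg ?_)) (le_add_of_nonneg_left
        (Real.exp_pos _).le)
      have h1 : 1 ≤ √n * t ^ 2 := by
        rw [← Real.log_nonneg_iff (by positivity), Real.log_mul (by positivity) (by positivity),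
          Real.log_sqrt hn0.le, Real.log_pow]
        rw [Real.log_inv] at h
        push_cast
        linarith
      have h2 : √n ≤ n * t ^ 2 := by
        have := mul_le_mul_of_nonneg_left h1 (Real.sqrt_nonneg n)
        rwa [mul_one, ← mul_assoc, Real.mul_self_sqrt hn0.le] at this
      have h3 : n * t ^ 2 ≤ n * (t ^ 2 * (1 + Real.log t⁻¹)) := by
        gcongr
        nlinarith [sq_nonneg t]
      nlinarith
  · rw [slow, timeLog, if_neg hα, if_neg hα]
    refine le_trans (Real.exp_le_exp.2 (neg_le_neg ?_)) (le_add_of_nonneg_right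
      (Real.exp_pos _).le)
    have : 0 ≤ c * n * t ^ (min α 2) := by positivity
    linarith

namespace IsPowerLawKernel

/-- The `n`-th power of the Fourier transform: away from the origin the spectral gap acts on all
but two of the factors, near the origin the local behaviour of `1 - charFn` decides. -/
theorem abs_charFn_pow_le {c : ℝ} (hc : 0 < c) (hL : 1 ≤ L) (hΔ : Δ < 1)
    (hP : IsPowerLawKernel α L Klb Kub Δ P)
    (hloc : ∀ k : Fin d → ℝ, k ≠ 0 → ‖k‖ ≤ L⁻¹ →
      c * ((L * ‖k‖) ^ (min α 2) * slow α (L * ‖k‖)⁻¹) ≤ 1 - charFn P k)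
    (hα : 0 < α) {n : ℕ} (hn : 2 ≤ n) {k : Fin d → ℝ} (hk : k ∈ cell d) :
    |charFn P k| ^ n ≤ (1 - Δ) ^ (n - 2) * charFn P k ^ 2 +
      (Real.exp (-(c / 4 * (n * timeLog α n) * (L * ‖k‖) ^ (min α 2))) +
        (Metric.closedBall 0 L⁻¹).indicator (fun _ => Real.exp (-(c * √n))) k) := by
  have hL0 : 0 < L := by linarith
  have ha : 0 < min α 2 := lt_min hα two_pos
  have hθ : 0 ≤ 1 - Δ := by linarith
  have hn1 : (1 : ℝ) ≤ n := by exact_mod_cast (by omega : 1 ≤ n)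
  have hrest : 0 ≤ (Metric.closedBall (0 : Fin d → ℝ) L⁻¹).indicator
      (fun _ => Real.exp (-(c * √n))) k :=
    Set.indicator_nonneg (fun _ _ => (Real.exp_pos _).le) _
  by_cases hgap : |charFn P k| ≤ 1 - Δ
  · have : |charFn P k| ^ n ≤ (1 - Δ) ^ (n - 2) * charFn P k ^ 2 := by
      rw [← sq_abs (charFn P k)]
      calc |charFn P k| ^ n = |charFn P k| ^ (n - 2) * |charFn P k| ^ 2 := by
            rw [← pow_add]; congr 1; omega
        _ ≤ _ := by gcongr
    have h2 := (Real.exp_pos (-(c / 4 * (n * timeLog α n) * (L * ‖k‖) ^ (min α 2)))).le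
    linarith
  · have h0 : 0 ≤ (1 - Δ) ^ (n - 2) * charFn P k ^ 2 := by positivity
    have hlow := hP.fourier_lt k (mem_cell.1 hk)
    rw [hP.fourier_re] at hlow
    have hkL : ‖k‖ ≤ L⁻¹ := by
      by_contra! h
      have := hP.fourier_gt k (mem_cell.1 hk) h
      rw [hP.fourier_re] at this
      exact hgap (abs_le.2 ⟨by linarith, by linarith⟩)
    have hpos : 0 ≤ charFn P k := by
      by_contra! h
      exact hgap (abs_le.2 ⟨by linarith, by linarith⟩)
    rw [abs_of_nonneg hpos, Set.indicator_of_mem (by simpa using hkL)]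
    refine le_trans ?_ (le_add_of_nonneg_left h0)
    by_cases hk0 : k = 0
    · subst hk0
      have h1 : charFn P (0 : Fin d → ℝ) ^ n ≤ 1 :=
        pow_le_one₀ hpos ((le_abs_self _).trans (hP.abs_charFn_le_one 0))
      have h2 := (Real.exp_pos (-(c * √n))).le
      simp only [norm_zero, mul_zero, Real.zero_rpow ha.ne', neg_zero, Real.exp_zero]
      linarith
    · have hnk : 0 < ‖k‖ := norm_pos_iff.2 hk0
      have hlk : L * ‖k‖ ≤ 1 := by
        have := mul_le_mul_of_nonneg_left hkL hL0.le
        rwa [mul_inv_cancel₀ hL0.ne'] at this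
      refine le_trans ?_ (exp_neg_slow_le hc (by positivity) hlk hn1)
      have h1 : charFn P k ≤
          Real.exp (-(c * ((L * ‖k‖) ^ (min α 2) * slow α (L * ‖k‖)⁻¹))) := by
        have := hloc k hk0 hkL
        have := Real.add_one_le_exp (-(c * ((L * ‖k‖) ^ (min α 2) * slow α (L * ‖k‖)⁻¹)))
        linarith
      refine (pow_le_pow_left₀ hpos h1 n).trans (le_of_eq ?_)
      rw [← Real.exp_nat_mul]
      congr 1
      ring

theorem volume_closedBall_toReal (hL : 0 < L) :
    (volume (Metric.closedBall (0 : Fin d → ℝ) L⁻¹)).toReal = 2 ^ d * L ^ (-(d : ℝ)) := by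
  rw [Real.volume_pi_closedBall _ (by positivity), ENNReal.toReal_ofReal (by positivity),
    Fintype.card_fin, mul_pow, Real.rpow_neg hL.le, Real.rpow_natCast, inv_pow]

theorem exists_walk_le (hd : 0 < d) (hα : 0 < α) (hKlb : 0 < Klb) (hKub : 0 < Kub)
    (hΔ : Δ ∈ Set.Ioo (0 : ℝ) 1) :
    ∃ C : ℝ, 0 < C ∧ ∀ L : ℝ, 1 ≤ L → ∀ P : (Fin d → ℤ) → ℝ,
      IsPowerLawKernel α L Klb Kub Δ P → ∀ n : ℕ, 1 ≤ n → ∀ x : Fin d → ℤ,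
      walk (fun y => ENNReal.ofReal (P y)) n x ≤ ENNReal.ofReal
        (C * L ^ (-(d : ℝ)) * ((n : ℝ) * timeLog α n) ^ (-((d : ℝ) / min α 2))) := by
  have hd0 : (0 : ℝ) < d := by exact_mod_cast hd
  have ha : 0 < min α 2 := lt_min hα two_pos
  obtain ⟨hΔ0, hΔ1⟩ := hΔ
  have hθ : 0 < 1 - Δ := by linarith
  have hθ1 : Real.log (1 - Δ) < 0 := Real.log_neg hθ (by linarith)
  obtain ⟨c, hc, hloc⟩ := exists_le_one_sub_charFn (d := d) hd hα hKlb
  set s := (d : ℝ) / min α 2 with hs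
  have hs0 : 0 < s := by positivity
  obtain ⟨C₁, hC₁, hgeom⟩ := exists_exp_neg_sqrt_le α (neg_pos.2 hθ1) hs0
  obtain ⟨C₂, hC₂, hexp⟩ := exists_exp_neg_sqrt_le α hc hs0
  set J := ∫ u : Fin d → ℝ, Real.exp (-‖u‖ ^ (min α 2)) with hJ
  have hJ0 : 0 ≤ J := integral_nonneg fun u => (Real.exp_pos _).le
  set A := ((1 - Δ) ^ 2)⁻¹ * C₁ * ((2 * Real.pi) ^ d * Kub) + ((c / 4) ^ (-s) * J + 2 ^ d * C₂)
    with hA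
  have hA0 : 0 < A := by positivity
  refine ⟨Kub + ((2 * Real.pi) ^ d)⁻¹ * A, by positivity, fun L hL P hP n hn x => ?_⟩
  have hL0 : 0 < L := by linarith
  have hn1 : (1 : ℝ) ≤ n := by exact_mod_cast hn
  have hlog := timeLog_pos α hn1
  set D := ((n : ℝ) * timeLog α n) ^ (-s) with hD
  have hD0 : 0 < D := by positivity
  rcases Nat.lt_or_ge 1 n with hn2 | hn2
  · refine (hP.walk_le_integral n x).trans (ENNReal.ofReal_le_ofReal ?_)
    have hcont := hP.continuous_charFn
    set T := c / 4 * ((n : ℝ) * timeLog α n) with hT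
    have hT0 : 0 < T := by positivity
    have hg1 : Integrable (fun k => (1 - Δ) ^ (n - 2) * charFn P k ^ 2)
        (volume.restrict (cell d)) := by
      refine Integrable.const_mul ?_ _
      refine Integrable.of_bound (C := 1) (by fun_prop : Continuous fun k =>
        charFn P k ^ 2).aestronglyMeasurable (Filter.Eventually.of_forall fun k => ?_)
      rw [norm_pow, Real.norm_eq_abs]
      exact pow_le_one₀ (abs_nonneg _) (hP.abs_charFn_le_one k)
    have hg2 : Integrable fun k : Fin d → ℝ => Real.exp (-(T * (L * ‖k‖) ^ (min α 2))) := by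
      simp_rw [exp_neg_mul_norm_rpow_eq ha hT0 _ hL0]
      exact (integrable_exp_neg_norm_rpow d ha).comp_smul (by positivity)
    have hball : volume (Metric.closedBall (0 : Fin d → ℝ) L⁻¹) ≠ ∞ :=
      measure_closedBall_lt_top.ne
    have hg3 : Integrable ((Metric.closedBall (0 : Fin d → ℝ) L⁻¹).indicator
        fun _ => Real.exp (-(c * √n))) :=
      (integrable_indicator_iff Metric.isClosed_closedBall.measurableSet).2
        (integrableOn_const hball)
    have hg23 : Integrable (fun k : Fin d → ℝ => Real.exp (-(T * (L * ‖k‖) ^ (min α 2))) +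
        (Metric.closedBall 0 L⁻¹).indicator (fun _ => Real.exp (-(c * √n))) k)
        (volume.restrict (cell d)) := hg2.integrableOn.add hg3.integrableOn
    have hint : ∫ k in cell d, |charFn P k| ^ n ≤
        (1 - Δ) ^ (n - 2) * ((2 * Real.pi) ^ d * (Kub * L ^ (-(d : ℝ)))) +
        (L ^ (-(d : ℝ)) * T ^ (-s) * J + 2 ^ d * L ^ (-(d : ℝ)) * Real.exp (-(c * √n))) := by
      calc ∫ k in cell d, |charFn P k| ^ n
          ≤ ∫ k in cell d, ((1 - Δ) ^ (n - 2) * charFn P k ^ 2 +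
              (Real.exp (-(T * (L * ‖k‖) ^ (min α 2))) +
              (Metric.closedBall 0 L⁻¹).indicator (fun _ => Real.exp (-(c * √n))) k)) := by
            refine setIntegral_mono_on ?_ (hg1.add hg23)
              measurableSet_cell fun k hk => hP.abs_charFn_pow_le hc hL hΔ1
                (hloc L hL Kub Δ P hP) hα hn2 hk
            refine Integrable.of_bound (C := 1) (by fun_prop : Continuous fun k =>
              |charFn P k| ^ n).aestronglyMeasurable (Filter.Eventually.of_forall fun k => ?_)
            rw [norm_pow, Real.norm_eq_abs, abs_abs]
            exact pow_le_one₀ (abs_nonneg _) (hP.abs_charFn_le_one k)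
        _ = (1 - Δ) ^ (n - 2) * (∫ k in cell d, charFn P k ^ 2) +
              ((∫ k in cell d, Real.exp (-(T * (L * ‖k‖) ^ (min α 2)))) +
              ∫ k in cell d, (Metric.closedBall (0 : Fin d → ℝ) L⁻¹).indicator
                (fun _ => Real.exp (-(c * √n))) k) := by
            rw [integral_add hg1 hg23, integral_const_mul,
              integral_add hg2.integrableOn hg3.integrableOn]
        _ ≤ _ := by
            refine add_le_add (mul_le_mul_of_nonneg_left
              (hP.integral_charFn_sq_le hα hL hKub) (by positivity)) (add_le_add ?_ ?_)
            · rw [← integral_exp_neg_mul_norm_rpow ha hT0 hL0]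
              exact setIntegral_le_integral hg2
                (Filter.Eventually.of_forall fun k => (Real.exp_pos _).le)
            · refine (setIntegral_le_integral hg3 (Filter.Eventually.of_forall fun k =>
                Set.indicator_nonneg (fun _ _ => (Real.exp_pos _).le) _)).trans (le_of_eq ?_)
              rw [integral_indicator Metric.isClosed_closedBall.measurableSet, setIntegral_const,
                smul_eq_mul, Measure.real, volume_closedBall_toReal hL0]
    have hgeom' : (1 - Δ) ^ (n - 2) ≤ ((1 - Δ) ^ 2)⁻¹ * (C₁ * D) := by
      have h1 : (1 - Δ) ^ n ≤ C₁ * D := by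
        refine le_trans ?_ (hgeom n hn1)
        rw [← Real.exp_log hθ, ← Real.exp_nat_mul, Real.exp_log hθ]
        refine Real.exp_le_exp.2 ?_
        have : √(n : ℝ) ≤ n := Real.sqrt_le_iff.2 ⟨by positivity, by nlinarith⟩
        nlinarith
      rw [← div_eq_inv_mul, le_div_iff₀ (by positivity), ← pow_add, Nat.sub_add_cancel hn2]
      exact h1
    have hT' : T ^ (-s) = (c / 4) ^ (-s) * D := by
      rw [hT, Real.mul_rpow (by positivity) (by positivity)]
    have hexp' := hexp n hn1
    have hLd : 0 < L ^ (-(d : ℝ)) := by positivity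
    calc ((2 * Real.pi) ^ d)⁻¹ * ∫ k in cell d, |charFn P k| ^ n
        ≤ ((2 * Real.pi) ^ d)⁻¹ * (((1 - Δ) ^ 2)⁻¹ * (C₁ * D) *
            ((2 * Real.pi) ^ d * (Kub * L ^ (-(d : ℝ)))) +
            (L ^ (-(d : ℝ)) * ((c / 4) ^ (-s) * D) * J +
              2 ^ d * L ^ (-(d : ℝ)) * (C₂ * D))) := by
          refine mul_le_mul_of_nonneg_left (hint.trans ?_) (by positivity)
          rw [hT']
          gcongr
      _ = ((2 * Real.pi) ^ d)⁻¹ * A * L ^ (-(d : ℝ)) * D := by rw [hA]; ring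
      _ ≤ _ := by
          gcongr
          linarith
  · obtain rfl : n = 1 := by omega
    rw [walk_one]
    refine ENNReal.ofReal_le_ofReal ((hP.le_sup hα hL hKub x).trans ?_)
    have hD1 : 1 ≤ D := by
      have := timeLog_le α (le_refl (1 : ℝ))
      rw [hD]
      exact Real.one_le_rpow_of_pos_of_le_one_of_nonpos (by positivity)
        (by push_cast; linarith) (by linarith)
    calc Kub * L ^ (-(d : ℝ)) ≤ (Kub + ((2 * Real.pi) ^ d)⁻¹ * A) * L ^ (-(d : ℝ)) := by
          gcongr
          have : 0 ≤ ((2 * Real.pi) ^ d)⁻¹ * A := by positivity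
          linarith
      _ ≤ _ := le_mul_of_one_le_right (by positivity) hD1

end IsPowerLawKernel

end OnDiagonal

/-! ### The time scale attached to a distance -/

section Scales

variable {α : ℝ}

/-- The logarithmic correction, as a function of the rescaled distance. -/
def spaceLog (α r : ℝ) : ℝ := if α = 2 then Real.log r else 1

/-- The number of steps that the walk needs to travel a distance `r`, in units of the range. -/
def growth (α r : ℝ) : ℝ := r ^ (min α 2) / spaceLog α r

theorem third_le_log {r : ℝ} (hr : Real.pi / 2 ≤ r) : 1 / 3 ≤ Real.log r := by
  have h : (3 : ℝ) / 2 ≤ r := by linarith [Real.pi_gt_three]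
  have h1 := Real.one_sub_inv_le_log_of_pos (x := 3 / 2) (by norm_num)
  have h2 := Real.log_le_log (by norm_num) h
  norm_num at h1
  linarith

theorem spaceLog_pos {r : ℝ} (hr : Real.pi / 2 ≤ r) : 0 < spaceLog α r := by
  unfold spaceLog
  split_ifs
  · linarith [third_le_log hr]
  · exact one_pos

theorem one_le_of_pi_div_two_le {r : ℝ} (hr : Real.pi / 2 ≤ r) : 1 ≤ r :=
  one_le_pi_div_two.trans hr

theorem growth_mul_spaceLog {r : ℝ} (hr : Real.pi / 2 ≤ r) :
    growth α r * spaceLog α r = r ^ (min α 2) :=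
  div_mul_cancel₀ _ (spaceLog_pos hr).ne'

theorem le_growth_two {r : ℝ} (hr : Real.pi / 2 ≤ r) : r ≤ growth 2 r := by
  have h1 := one_le_of_pi_div_two_le hr
  rw [growth, spaceLog, if_pos rfl, min_self, Real.rpow_two, le_div_iff₀
    (by linarith [third_le_log hr]), sq]
  have := Real.log_le_sub_one_of_pos (by linarith : 0 < r)
  gcongr
  linarith

theorem one_le_growth (hα : 0 < α) {r : ℝ} (hr : Real.pi / 2 ≤ r) : 1 ≤ growth α r := by
  have h1 := one_le_of_pi_div_two_le hr
  by_cases h : α = 2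
  · subst h
    exact h1.trans (le_growth_two hr)
  · rw [growth, spaceLog, if_neg h, div_one]
    exact Real.one_le_rpow h1 (lt_min hα two_pos).le

theorem spaceLog_le_timeLog {r n : ℝ} (hr : Real.pi / 2 ≤ r) (hn : growth α r ≤ n) :
    spaceLog α r ≤ timeLog α n := by
  have h1 := one_le_of_pi_div_two_le hr
  by_cases h : α = 2
  · subst h
    rw [spaceLog, timeLog, if_pos rfl, if_pos rfl]
    exact Real.log_le_log (by linarith) (by linarith [le_growth_two hr])
  · rw [spaceLog, timeLog, if_neg h, if_neg h]

theorem spaceLog_mul_le {r n : ℝ} (hr : Real.pi / 2 ≤ r) (hn1 : 1 ≤ n) (hn : n ≤ growth α r) :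
    spaceLog α r * n ≤ 8 * (timeLog α n * growth α r) := by
  have h1 := one_le_of_pi_div_two_le hr
  by_cases h : α = 2
  · subst h
    have hlog := third_le_log hr
    rcases le_total r n with hrn | hrn
    · have h2 : spaceLog 2 r ≤ timeLog 2 n := by
        rw [spaceLog, timeLog, if_pos rfl, if_pos rfl]
        exact Real.log_le_log (by linarith) (by linarith)
      have h3 := timeLog_pos 2 hn1
      calc spaceLog 2 r * n ≤ timeLog 2 n * growth 2 r := by gcongr
        _ ≤ _ := by
          have : 0 ≤ timeLog 2 n * growth 2 r := by
            have := le_growth_two hr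
            have : 0 ≤ growth 2 r := by linarith
            positivity
          linarith
    · have h2 : (1 : ℝ) / 2 ≤ timeLog 2 n := by
        rw [timeLog, if_pos rfl]
        have := Real.log_le_log two_pos (by linarith : (2 : ℝ) ≤ 1 + n)
        linarith [Real.log_two_gt_d9]
      have h3 : Real.log r ^ 2 ≤ 4 * r := by
        have := Real.log_le_rpow_div (by linarith : 0 ≤ r) (by norm_num : (0 : ℝ) < 1 / 2)
        rw [← Real.sqrt_eq_rpow] at this
        calc Real.log r ^ 2 ≤ (√r / (1 / 2)) ^ 2 := by gcongr
          _ = 4 * r := by rw [div_pow, Real.sq_sqrt (by linarith)]; ring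
      have h4 : Real.log r * r ≤ 4 * growth 2 r := by
        rw [growth, spaceLog, if_pos rfl, min_self, Real.rpow_two, ← mul_div_assoc,
          le_div_iff₀ (by linarith)]
        nlinarith
      have h5 := le_growth_two hr
      calc spaceLog 2 r * n ≤ Real.log r * r := by
            rw [spaceLog, if_pos rfl]
            gcongr
        _ ≤ 4 * growth 2 r := h4
        _ ≤ 8 * (timeLog 2 n * growth 2 r) := by nlinarith
  · rw [spaceLog, timeLog, if_neg h, if_neg h]
    linarith

theorem rpow_neg_le_div_growth {r : ℝ} (hr : Real.pi / 2 ≤ r) :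
    r ^ (-α) ≤ 3 / growth α r := by
  have h1 := one_le_of_pi_div_two_le hr
  have h0 : 0 < r := by linarith
  rw [growth, div_div_eq_mul_div, le_div_iff₀ (by positivity), ← Real.rpow_add h0]
  have h2 : r ^ (-α + min α 2) ≤ 1 :=
    Real.rpow_le_one_of_one_le_of_nonpos h1 (by linarith [min_le_left α 2])
  refine h2.trans ?_
  unfold spaceLog
  split_ifs
  · linarith [third_le_log hr]
  · norm_num

theorem sq_mul_slow_le {r : ℝ} (hr : Real.pi / 2 ≤ r) :
    r ^ (2 - min α 2) * slow α r ≤ 4 * (r ^ 2 / growth α r) := by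
  have h0 : 0 < r := by linarith [one_le_of_pi_div_two_le hr]
  have h2 : slow α r ≤ 4 * spaceLog α r := by
    unfold slow spaceLog
    split_ifs
    · linarith [third_le_log hr]
    · norm_num
  rw [growth, div_div_eq_mul_div, Real.rpow_sub h0, Real.rpow_two]
  calc r ^ 2 / r ^ (min α 2) * slow α r ≤ r ^ 2 / r ^ (min α 2) * (4 * spaceLog α r) := by gcongr
    _ = _ := by ring

theorem rpow_min_rpow_neg (d : ℕ) (hα : 0 < α) {r : ℝ} (hr : 0 < r) :
    (r ^ (min α 2)) ^ (-((d : ℝ) / min α 2)) = r ^ (-(d : ℝ)) := by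
  have ha : 0 < min α 2 := lt_min hα two_pos
  rw [← Real.rpow_mul hr.le]
  congr 1
  field_simp

theorem rpow_time_le (d : ℕ) (hα : 0 < α) {r n : ℝ} (hr : Real.pi / 2 ≤ r)
    (hn : growth α r ≤ n) :
    (n * timeLog α n) ^ (-((d : ℝ) / min α 2)) ≤ r ^ (-(d : ℝ)) := by
  have h0 : 0 < r := by linarith [one_le_of_pi_div_two_le hr]
  have ha : 0 < min α 2 := lt_min hα two_pos
  have hg := one_le_growth hα hr
  rw [← rpow_min_rpow_neg d hα h0, ← growth_mul_spaceLog hr]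
  have hl := spaceLog_pos (α := α) hr
  refine Real.rpow_le_rpow_of_nonpos (by positivity) ?_ (neg_nonpos.2 (by positivity))
  have := spaceLog_le_timeLog hr hn
  gcongr
  linarith

theorem rpow_time_le' (d : ℕ) (hα : 0 < α) {r n : ℝ} (hr : Real.pi / 2 ≤ r) (hn1 : 1 ≤ n)
    (hn : n ≤ growth α r) :
    (n * timeLog α n) ^ (-((d : ℝ) / min α 2)) ≤ 8 ^ ((d : ℝ) / min α 2) *
      (n / growth α r) ^ (-(2 * ((d : ℝ) / min α 2))) * r ^ (-(d : ℝ)) := by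
  have h0 : 0 < r := by linarith [one_le_of_pi_div_two_le hr]
  have ha : 0 < min α 2 := lt_min hα two_pos
  have hg := one_le_growth hα hr
  have hn0 : 0 < n := by linarith
  have hl := spaceLog_pos (α := α) hr
  have hz : 0 < n / growth α r := by positivity
  have h8 : (8 : ℝ) ^ ((d : ℝ) / min α 2) = (8⁻¹ : ℝ) ^ (-((d : ℝ) / min α 2)) := by
    rw [Real.inv_rpow (by norm_num), Real.rpow_neg (by norm_num), inv_inv]
  have hz2 : (n / growth α r) ^ (-(2 * ((d : ℝ) / min α 2))) =
      ((n / growth α r) ^ 2) ^ (-((d : ℝ) / min α 2)) := by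
    rw [← Real.rpow_two, ← Real.rpow_mul hz.le]
    congr 1
    ring
  rw [← rpow_min_rpow_neg d hα h0, ← growth_mul_spaceLog hr, h8, hz2,
    ← Real.mul_rpow (by positivity) (by positivity),
    ← Real.mul_rpow (by positivity) (by positivity)]
  refine Real.rpow_le_rpow_of_nonpos (by positivity) ?_ (neg_nonpos.2 (by positivity))
  have h := spaceLog_mul_le hr hn1 hn
  have e : 8⁻¹ * (n / growth α r) ^ 2 * (growth α r * spaceLog α r) =
      n * (spaceLog α r * n) / (8 * growth α r) := by
    field_simp
  rw [e, div_le_iff₀ (by positivity)]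
  nlinarith

theorem timeLog_three_mul_le {m n : ℝ} (hm : 1 ≤ m) (hn : 1 ≤ n) (h : n ≤ 3 * m) :
    n * timeLog α n ≤ 6 * (m * timeLog α m) := by
  have h1 : timeLog α n ≤ 2 * timeLog α m := by
    unfold timeLog
    split_ifs
    · have : Real.log (1 + n) ≤ Real.log ((1 + m) ^ 2) :=
        Real.log_le_log (by linarith) (by nlinarith)
      rw [Real.log_pow] at this
      exact_mod_cast this
    · norm_num
  have h2 := timeLog_pos α hn
  have h3 := timeLog_pos α hm
  calc n * timeLog α n ≤ 3 * m * (2 * timeLog α m) := by gcongr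
    _ = _ := by ring

end Scales

/-! ### Exponential moments of the truncated walk -/

section Chernoff

variable {d : ℕ} {α L Klb Kub Δ : ℝ} {P : (Fin d → ℤ) → ℝ}

theorem exp_le_quadratic (t : ℝ) : Real.exp t ≤ 1 + t + t ^ 2 * Real.exp |t| := by
  have h := Complex.norm_exp_sub_sum_le_norm_mul_exp (t : ℂ) 2
  have e : Complex.exp t - ∑ m ∈ Finset.range 2, (t : ℂ) ^ m / m.factorial =
      ((Real.exp t - 1 - t : ℝ) : ℂ) := by
    simp [Finset.sum_range_succ]
    ring
  rw [e, Complex.norm_real, Complex.norm_real, Real.norm_eq_abs, Real.norm_eq_abs, sq_abs] at h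
  linarith [le_abs_self (Real.exp t - 1 - t)]

/-- The part of the step law that is carried by the box of size `M`. -/
def shortSteps (P : (Fin d → ℤ) → ℝ) (M : ℕ) : (Fin d → ℤ) → ℝ≥0∞ :=
  (box d M : Set (Fin d → ℤ)).indicator fun y => ENNReal.ofReal (P y)

namespace IsPowerLawKernel

theorem sum_box_mul_exp_le (hP : IsPowerLawKernel α L Klb Kub Δ P) (M : ℕ) (i : Fin d)
    (κ : ℝ) {V : ℝ} (hV : ∑ x ∈ box d M, P x * ‖x‖ ^ 2 ≤ V) :
    ∑ x ∈ box d M, P x * Real.exp (κ * x i) ≤ Real.exp (κ ^ 2 * Real.exp (|κ| * M) * V) := by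
  have hmean : ∑ x ∈ box d M, P x * (x i : ℝ) = 0 := by
    have h : ∑ x ∈ box d M, P x * (x i : ℝ) = ∑ x ∈ box d M, -(P x * (x i : ℝ)) := by
      refine Finset.sum_equiv (reflect i) (fun x => ?_) fun x _ => ?_
      · rw [mem_box_iff_norm, mem_box_iff_norm, norm_reflect]
      · rw [hP.symmetric.reflect, reflect_apply, Function.update_self]
        push_cast
        ring
    rw [Finset.sum_neg_distrib] at h
    linarith
  have hone : ∑ x ∈ box d M, P x ≤ 1 :=
    sum_le_hasSum _ (fun x _ => hP.nonneg x) hP.hasSum_one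
  calc ∑ x ∈ box d M, P x * Real.exp (κ * x i)
      ≤ ∑ x ∈ box d M, (P x + κ * (P x * (x i : ℝ)) +
          κ ^ 2 * Real.exp (|κ| * M) * (P x * ‖x‖ ^ 2)) := by
        refine Finset.sum_le_sum fun x hx => ?_
        have hxi : |(x i : ℝ)| ≤ ‖x‖ := by
          simpa [Int.norm_eq_abs] using norm_le_pi_norm x i
        have hxM : |(x i : ℝ)| ≤ M := hxi.trans (mem_box_iff_norm.1 hx)
        have h1 : Real.exp |κ * x i| ≤ Real.exp (|κ| * M) := by
          rw [abs_mul]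
          gcongr
        have h2 : (x i : ℝ) ^ 2 ≤ ‖x‖ ^ 2 := by
          rw [← sq_abs (x i : ℝ)]
          gcongr
        calc P x * Real.exp (κ * x i)
            ≤ P x * (1 + κ * x i + (κ * x i) ^ 2 * Real.exp |κ * x i|) :=
              mul_le_mul_of_nonneg_left (exp_le_quadratic _) (hP.nonneg x)
          _ = P x + κ * (P x * x i) + P x * (κ ^ 2 * ((x i : ℝ) ^ 2 * Real.exp |κ * x i|)) := by
              ring
          _ ≤ P x + κ * (P x * x i) + P x * (κ ^ 2 * (‖x‖ ^ 2 * Real.exp (|κ| * M))) := by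
              have := hP.nonneg x
              gcongr
          _ = _ := by ring
    _ = ∑ x ∈ box d M, P x + κ * ∑ x ∈ box d M, P x * (x i : ℝ) +
          κ ^ 2 * Real.exp (|κ| * M) * ∑ x ∈ box d M, P x * ‖x‖ ^ 2 := by
        rw [Finset.sum_add_distrib, Finset.sum_add_distrib, Finset.mul_sum, Finset.mul_sum]
    _ ≤ 1 + κ * 0 + κ ^ 2 * Real.exp (|κ| * M) * V := by
        rw [hmean]
        gcongr
    _ ≤ _ := by
        have := Real.add_one_le_exp (κ ^ 2 * Real.exp (|κ| * M) * V)
        linarith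

theorem tsum_shortSteps_mul_exp_le (hP : IsPowerLawKernel α L Klb Kub Δ P) (M : ℕ) (i : Fin d)
    (κ : ℝ) {V : ℝ} (hV : ∑ x ∈ box d M, P x * ‖x‖ ^ 2 ≤ V) (n : ℕ) :
    ∑' x, walk (shortSteps P M) n x * ENNReal.ofReal (Real.exp (κ * x i)) ≤
      ENNReal.ofReal (Real.exp (n * (κ ^ 2 * Real.exp (|κ| * M) * V))) := by
  rw [tsum_walk_mul _ (fun x : Fin d → ℤ => ENNReal.ofReal (Real.exp (κ * x i))) (by simp)
    (fun x y => by
      rw [← ENNReal.ofReal_mul (Real.exp_pos _).le, ← Real.exp_add]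
      congr 2
      simp only [Pi.add_apply]
      push_cast
      ring), Real.exp_nat_mul, ENNReal.ofReal_pow (Real.exp_pos _).le]
  gcongr
  rw [tsum_eq_sum (s := box d M) fun x hx => by
    rw [shortSteps, Set.indicator_of_notMem (by simpa using hx), zero_mul]]
  refine le_trans (le_of_eq ?_) (ENNReal.ofReal_le_ofReal (hP.sum_box_mul_exp_le M i κ hV))
  rw [ENNReal.ofReal_sum_of_nonneg fun x _ => mul_nonneg (hP.nonneg x) (Real.exp_pos _).le]
  refine Finset.sum_congr rfl fun x hx => ?_
  rw [shortSteps, Set.indicator_of_mem (by simpa using hx), ENNReal.ofReal_mul (hP.nonneg x)]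

/-- Chernoff's bound for the walk with truncated steps. -/
theorem tsum_tail_shortSteps_le (hd : 0 < d) (hP : IsPowerLawKernel α L Klb Kub Δ P) (M : ℕ)
    {κ : ℝ} (hκ : 0 ≤ κ) {V : ℝ} (hV : ∑ x ∈ box d M, P x * ‖x‖ ^ 2 ≤ V) (n : ℕ) (t : ℝ) :
    ∑' x, {y : Fin d → ℤ | t ≤ ‖y‖}.indicator (walk (shortSteps P M) n) x ≤
      ENNReal.ofReal (2 * d * Real.exp (-(κ * t)) *
        Real.exp (n * (κ ^ 2 * Real.exp (κ * M) * V))) := by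
  set w := walk (shortSteps P M) n with hw
  set B := ENNReal.ofReal (Real.exp (n * (κ ^ 2 * Real.exp (κ * M) * V))) with hB
  have hplus : ∀ i : Fin d, ∑' x, w x * ENNReal.ofReal (Real.exp (κ * x i)) ≤ B := fun i => by
    simpa [abs_of_nonneg hκ] using hP.tsum_shortSteps_mul_exp_le M i κ hV n
  have hminus : ∀ i : Fin d, ∑' x, w x * ENNReal.ofReal (Real.exp (-κ * x i)) ≤ B := fun i => by
    simpa [abs_of_nonneg hκ] using hP.tsum_shortSteps_mul_exp_le M i (-κ) hV n
  have hpt : ∀ x : Fin d → ℤ, {y : Fin d → ℤ | t ≤ ‖y‖}.indicator w x ≤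
      ENNReal.ofReal (Real.exp (-(κ * t))) * ∑ i, (w x * ENNReal.ofReal (Real.exp (κ * x i)) +
        w x * ENNReal.ofReal (Real.exp (-κ * x i))) := by
    intro x
    by_cases hx : x ∈ {y : Fin d → ℤ | t ≤ ‖y‖}
    swap
    · rw [Set.indicator_of_notMem hx]
      exact bot_le
    rw [Set.indicator_of_mem hx]
    obtain ⟨i, hi⟩ := exists_norm_apply_eq hd x
    rw [Int.norm_eq_abs] at hi
    have hsingle : w x * ENNReal.ofReal (Real.exp (κ * x i)) +
        w x * ENNReal.ofReal (Real.exp (-κ * x i)) ≤ _ :=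
      Finset.single_le_sum_of_canonicallyOrdered (f := fun i =>
        w x * ENNReal.ofReal (Real.exp (κ * x i)) + w x * ENNReal.ofReal (Real.exp (-κ * x i)))
        (Finset.mem_univ i)
    refine le_trans ?_ (mul_le_mul_right hsingle _)
    have hxt : t ≤ |(x i : ℝ)| := by rw [hi]; exact hx
    have h1 : (1 : ℝ≥0∞) ≤ ENNReal.ofReal (Real.exp (-(κ * t))) *
        (ENNReal.ofReal (Real.exp (κ * x i)) + ENNReal.ofReal (Real.exp (-κ * x i))) := by
      rw [← ENNReal.ofReal_add (Real.exp_pos _).le (Real.exp_pos _).le,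
        ← ENNReal.ofReal_mul (Real.exp_pos _).le, ENNReal.one_le_ofReal, mul_add,
        ← Real.exp_add, ← Real.exp_add]
      have hexp : ∀ u : ℝ, 0 < Real.exp u := Real.exp_pos
      rcases abs_cases (x i : ℝ) with ⟨h, -⟩ | ⟨h, -⟩
      · have : 1 ≤ Real.exp (-(κ * t) + κ * x i) := Real.one_le_exp (by nlinarith)
        linarith [hexp (-(κ * t) + -κ * x i)]
      · have : 1 ≤ Real.exp (-(κ * t) + -κ * x i) := Real.one_le_exp (by nlinarith)
        linarith [hexp (-(κ * t) + κ * x i)]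
    calc w x = w x * 1 := (mul_one _).symm
      _ ≤ w x * _ := mul_le_mul_right h1 _
      _ = _ := by ring
  calc _ ≤ _ := ENNReal.tsum_le_tsum hpt
    _ = ENNReal.ofReal (Real.exp (-(κ * t))) *
        ∑ i, (∑' x, w x * ENNReal.ofReal (Real.exp (κ * x i)) +
          ∑' x, w x * ENNReal.ofReal (Real.exp (-κ * x i))) := by
        rw [ENNReal.tsum_mul_left, Summable.tsum_finsetSum fun _ _ => ENNReal.summable]
        congr 1
        exact Finset.sum_congr rfl fun i _ => ENNReal.tsum_add
    _ ≤ ENNReal.ofReal (Real.exp (-(κ * t))) * ∑ _i : Fin d, (B + B) := by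
        gcongr with i
        · exact hplus i
        · exact hminus i
    _ = _ := by
        rw [Finset.sum_const, Finset.card_univ, Fintype.card_fin, hB, ← ENNReal.ofReal_add
          (Real.exp_pos _).le (Real.exp_pos _).le, nsmul_eq_mul, ← ENNReal.ofReal_natCast,
          ← ENNReal.ofReal_mul (by positivity), ← ENNReal.ofReal_mul (Real.exp_pos _).le]
        congr 1
        ring

end IsPowerLawKernel

end Chernoff

/-! ### The decay of transition probabilities in space -/

section OffDiagonal

variable {d : ℕ} {α L Klb Kub Δ : ℝ} {P : (Fin d → ℤ) → ℝ}

/-- The Euclidean norm in units of the range `L`, regularised at `1`. -/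
def scaledNorm (L : ℝ) (x : Fin d → ℤ) : ℝ := tnorm 1 (L⁻¹ • toEuclid x)

theorem pi_div_two_le_scaledNorm (L : ℝ) (x : Fin d → ℤ) : Real.pi / 2 ≤ scaledNorm L x :=
  le_mul_of_one_le_right (by positivity) (le_max_right _ _)

theorem tnorm_eq_mul_scaledNorm (hL : 0 < L) (x : Fin d → ℤ) :
    tnorm L (toEuclid x) = L * scaledNorm L x := by
  have h : max ‖toEuclid x‖ L = L * max (L⁻¹ * ‖toEuclid x‖) 1 := by
    rw [mul_max_of_nonneg _ _ hL.le, mul_one, mul_inv_cancel_left₀ hL.ne']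
  rw [scaledNorm, tnorm, tnorm, norm_smul, norm_inv, Real.norm_eq_abs, abs_of_pos hL, h]
  ring

theorem log_inv_sq_mul_sqrt_le {z : ℝ} (hz : 0 < z) (hz1 : z ≤ 1) :
    z * (Real.log z⁻¹ ^ 2 * Real.exp (Real.log z⁻¹ / 2)) ≤ 16 := by
  have hi : 0 < z⁻¹ := inv_pos.2 hz
  have hl : 0 ≤ Real.log z⁻¹ := Real.log_nonneg ((one_le_inv₀ hz).2 hz1)
  have h1 := Real.log_le_rpow_div hi.le (by norm_num : (0 : ℝ) < 1 / 4)
  have h2 : Real.log z⁻¹ ^ 2 ≤ 16 * Real.exp (Real.log z⁻¹ / 2) := by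
    calc Real.log z⁻¹ ^ 2 ≤ (z⁻¹ ^ (1 / 4 : ℝ) / (1 / 4)) ^ 2 := by gcongr
      _ = 16 * (z⁻¹ ^ (1 / 4 : ℝ)) ^ 2 := by ring
      _ = 16 * Real.exp (Real.log z⁻¹ / 2) := by
        rw [Real.rpow_def_of_pos hi, ← Real.exp_nat_mul]
        congr 2
        push_cast
        ring
  have h3 : Real.exp (Real.log z⁻¹ / 2) * Real.exp (Real.log z⁻¹ / 2) = z⁻¹ := by
    rw [← Real.exp_add, add_halves, Real.exp_log hi]
  calc z * (Real.log z⁻¹ ^ 2 * Real.exp (Real.log z⁻¹ / 2))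
      ≤ z * (16 * Real.exp (Real.log z⁻¹ / 2) * Real.exp (Real.log z⁻¹ / 2)) := by gcongr
    _ = 16 * (z * z⁻¹) := by rw [mul_assoc (16 : ℝ), h3]; ring
    _ = 16 := by rw [mul_inv_cancel₀ hz.ne', mul_one]

namespace IsPowerLawKernel

theorem le_of_mul_le_norm (hα : 0 < α) (hL : 1 ≤ L) (hKub : 0 < Kub)
    (hP : IsPowerLawKernel α L Klb Kub Δ P) {η r : ℝ} (hη : 0 < η) (hr : Real.pi / 2 ≤ r)
    {y : Fin d → ℤ} (hy : η * (L * r) ≤ ‖y‖) :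
    P y ≤ 3 * Kub * η ^ (-((d : ℝ) + α)) * ((L * r) ^ (-(d : ℝ)) / growth α r) := by
  have hL0 : 0 < L := by linarith
  have hr0 : 0 < r := by linarith [one_le_of_pi_div_two_le hr]
  have hg := one_le_growth hα hr
  have h1 : profile d α L ‖y‖ ≤ L ^ α / (η * (L * r)) ^ ((d : ℝ) + α) := by
    unfold profile
    gcongr
    exact hy.trans (le_max_left _ _)
  have h2 : L ^ α / (η * (L * r)) ^ ((d : ℝ) + α) =
      η ^ (-((d : ℝ) + α)) * (L * r) ^ (-(d : ℝ)) * r ^ (-α) := by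
    rw [Real.mul_rpow hη.le (by positivity), Real.rpow_add (by positivity : 0 < L * r),
      Real.mul_rpow (z := α) hL0.le hr0.le, Real.rpow_neg hη.le, Real.rpow_neg (by positivity),
      Real.rpow_neg hr0.le]
    field_simp
  calc P y ≤ Kub * profile d α L ‖y‖ := hP.le_profile hα hL hKub y
    _ ≤ Kub * (η ^ (-((d : ℝ) + α)) * (L * r) ^ (-(d : ℝ)) * (3 / growth α r)) := by
        refine mul_le_mul_of_nonneg_left ?_ hKub.le
        refine h1.trans (h2.le.trans ?_)
        gcongr
        exact rpow_neg_le_div_growth hr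
    _ = _ := by ring

/-- The walk without steps longer than a small multiple of `‖x‖` reaches `x` with a probability
that is small with respect to the ratio of the elapsed time to the time scale of `x`. One half of
the journey covers half of the distance, which Chernoff's bound makes unlikely by an arbitrary
power of that ratio; the other half is bounded uniformly. -/
theorem exists_walk_shortSteps_le (hd : 0 < d) (hα : 0 < α) (hKlb : 0 < Klb) (hKub : 0 < Kub)
    (hΔ : Δ ∈ Set.Ioo (0 : ℝ) 1) {η : ℝ} (hη : 0 < η) :
    ∃ ε C : ℝ, 0 < ε ∧ ε ≤ 1 ∧ 0 < C ∧ ∀ L : ℝ, 1 ≤ L → ∀ P : (Fin d → ℤ) → ℝ,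
      IsPowerLawKernel α L Klb Kub Δ P → ∀ n : ℕ, 2 ≤ n → ∀ (x : Fin d → ℤ) (r : ℝ),
      Real.pi / 2 ≤ r → n < growth α r → η * (L * r) ≤ ‖x‖ → ‖x‖ ≤ L * r →
      walk (shortSteps P ⌊ε * ‖x‖⌋₊) n x ≤ ENNReal.ofReal
        (C * (L * r) ^ (-(d : ℝ)) * (n / growth α r)) := by
  obtain ⟨C₀, hC₀, hon⟩ := exists_walk_le hd hα hKlb hKub hΔ
  obtain ⟨C₁, hC₁, hV⟩ := exists_sum_box_le (d := d) hd hα hKub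
  have ha : 0 < min α 2 := lt_min hα two_pos
  set s := (d : ℝ) / min α 2 with hs
  have hs0 : 0 < s := by positivity
  -- with this `ε` Chernoff's bound yields the power `1 + 2 * s` of the ratio
  set ε := 1 / (4 * (1 + 2 * s)) with hε
  have hε0 : 0 < ε := by positivity
  have hε1 : ε ≤ 1 := by
    rw [hε, div_le_one (by positivity)]
    linarith
  set E := 16 * (4 * C₁) / (4 * ε ^ 2 * η ^ 2) with hE
  refine ⟨ε, 2 * (2 * d * Real.exp E * (C₀ * 6 ^ s * 8 ^ s)), hε0, hε1, by positivity,
    fun L hL P hP n hn x r hr hng hηx hxr => ?_⟩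
  have hL0 : 0 < L := by linarith
  have hr1 := one_le_of_pi_div_two_le hr
  have hr0 : 0 < r := by linarith
  have hg := one_le_growth hα hr
  set g := growth α r with hgdef
  have hg0 : 0 < g := by linarith
  set X := ‖x‖ with hX
  have hX0 : 0 < X := lt_of_lt_of_le (by positivity) hηx
  have hn1 : (1 : ℝ) ≤ n := by exact_mod_cast (by omega : 1 ≤ n)
  set z := (n : ℝ) / g with hz
  have hz0 : 0 < z := by positivity
  have hz1 : z < 1 := (div_lt_one hg0).2 hng
  set M := ⌊ε * X⌋₊ with hM
  have hMX : (M : ℝ) ≤ ε * X := Nat.floor_le (by positivity)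
  set l := Real.log z⁻¹ with hl
  have hl0 : 0 ≤ l := Real.log_nonneg ((one_le_inv₀ hz0).2 hz1.le)
  set κ := l / (2 * ε * X) with hκ
  have hκ0 : 0 ≤ κ := by positivity
  set V := C₁ * (4 * ((L * r) ^ 2 / g)) with hVdef
  have hV0 : 0 ≤ V := by positivity
  have hmoment : ∑ y ∈ box d M, P y * ‖y‖ ^ 2 ≤ V := by
    have hρ : L ≤ L * r := by nlinarith
    have hMr : (M : ℝ) ≤ L * r := by nlinarith
    refine (hV L hL Klb Δ P hP (L * r) hρ M hMr).trans ?_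
    rw [mul_div_cancel_left₀ r hL0.ne', hVdef, mul_assoc (L ^ 2)]
    refine mul_le_mul_of_nonneg_left ?_ hC₁.le
    calc L ^ 2 * (r ^ (2 - min α 2) * slow α r) ≤ L ^ 2 * (4 * (r ^ 2 / g)) :=
          mul_le_mul_of_nonneg_left (sq_mul_slow_le hr) (by positivity)
      _ = _ := by ring
  -- the exponent in Chernoff's bound stays bounded
  have hexponent : ∀ m : ℕ, m ≤ n → (m : ℝ) * (κ ^ 2 * Real.exp (κ * M) * V) ≤ E := by
    intro m hmn
    have h1 : Real.exp (κ * M) ≤ Real.exp (l / 2) := by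
      refine Real.exp_le_exp.2 ((mul_le_mul_of_nonneg_left hMX hκ0).trans (le_of_eq ?_))
      rw [hκ]
      field_simp
    have h2 : (L * r) ^ 2 ≤ X ^ 2 / η ^ 2 := by
      rw [le_div_iff₀ (by positivity), ← mul_pow]
      refine pow_le_pow_left₀ (by positivity) ?_ 2
      linarith
    calc (m : ℝ) * (κ ^ 2 * Real.exp (κ * M) * V)
        ≤ (n : ℝ) * (κ ^ 2 * Real.exp (l / 2) * (C₁ * (4 * ((X ^ 2 / η ^ 2) / g)))) := by
          rw [hVdef]
          gcongr
      _ = z * (l ^ 2 * Real.exp (l / 2)) * ((4 * C₁) / (4 * ε ^ 2 * η ^ 2)) := by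
          rw [hκ, hz]
          field_simp
          ring
      _ ≤ 16 * ((4 * C₁) / (4 * ε ^ 2 * η ^ 2)) := by
          gcongr
          exact log_inv_sq_mul_sqrt_le hz0 hz1.le
      _ = E := by rw [hE]; ring
  have hdecay : Real.exp (-(κ * (X / 2))) = z ^ (1 + 2 * s) := by
    rw [Real.rpow_def_of_pos hz0, hκ, hl, Real.log_inv, hε]
    congr 1
    field_simp
    ring
  have htail : ∀ m : ℕ, m ≤ n →
      ∑' y, {y : Fin d → ℤ | X / 2 ≤ ‖y‖}.indicator (walk (shortSteps P M) m) y ≤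
        ENNReal.ofReal (2 * d * z ^ (1 + 2 * s) * Real.exp E) := by
    intro m hmn
    refine (hP.tsum_tail_shortSteps_le hd M hκ0 hmoment m (X / 2)).trans ?_
    refine ENNReal.ofReal_le_ofReal ?_
    rw [hdecay]
    gcongr
    exact hexponent m hmn
  have hsup : ∀ m : ℕ, 1 ≤ m → n ≤ 3 * m → ∀ y, walk (shortSteps P M) m y ≤
      ENNReal.ofReal (C₀ * 6 ^ s * 8 ^ s * (L * r) ^ (-(d : ℝ)) * z ^ (-(2 * s))) := by
    intro m hm hnm y
    have hm1 : (1 : ℝ) ≤ m := by exact_mod_cast hm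
    have hmono : ∀ y, shortSteps P M y ≤ ENNReal.ofReal (P y) := fun y =>
      Set.indicator_le_self _ (fun y => ENNReal.ofReal (P y)) y
    refine (walk_mono hmono m y).trans ((hon L hL P hP m hm y).trans
      (ENNReal.ofReal_le_ofReal ?_))
    have hlogm := timeLog_pos α hm1
    have hlogn := timeLog_pos α hn1
    have h6 : ((m : ℝ) * timeLog α m) ^ (-s) ≤ 6 ^ s * ((n : ℝ) * timeLog α n) ^ (-s) := by
      have h := timeLog_three_mul_le (α := α) hm1 hn1 (by exact_mod_cast hnm)
      have e : (6 : ℝ) ^ s = (6⁻¹ : ℝ) ^ (-s) := by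
        rw [Real.inv_rpow (by norm_num), Real.rpow_neg (by norm_num), inv_inv]
      rw [e, ← Real.mul_rpow (by norm_num) (by positivity)]
      exact Real.rpow_le_rpow_of_nonpos (by positivity) (by linarith) (by linarith)
    have h8 := rpow_time_le' d hα hr hn1 hng.le
    calc C₀ * L ^ (-(d : ℝ)) * ((m : ℝ) * timeLog α m) ^ (-s)
        ≤ C₀ * L ^ (-(d : ℝ)) * (6 ^ s * (8 ^ s * z ^ (-(2 * s)) * r ^ (-(d : ℝ)))) := by
          gcongr
          refine h6.trans ?_
          gcongr
      _ = _ := by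
          rw [Real.mul_rpow hL0.le hr0.le]
          ring
  have hT : ∀ y : Fin d → ℤ, y ∈ {y : Fin d → ℤ | X / 2 ≤ ‖y‖} ∨
      x - y ∈ {y : Fin d → ℤ | X / 2 ≤ ‖y‖} := by
    intro y
    by_contra! h
    obtain ⟨h1, h2⟩ := h
    simp only [Set.mem_ofPred_eq, not_le] at h1 h2
    have := norm_add_le y (x - y)
    rw [add_sub_cancel] at this
    linarith
  have hsplit : n / 2 + (n - n / 2) = n := by omega
  have h := walk_add_le_of_tail (shortSteps P M) (m := n / 2) (n := n - n / 2) hT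
    (hsup _ (by omega) (by omega)) (hsup _ (by omega) (by omega))
    (htail _ (by omega)) (htail _ (by omega))
  rw [hsplit] at h
  refine h.trans (le_of_eq ?_)
  rw [← ENNReal.ofReal_mul (by positivity), show (2 : ℝ≥0∞) = ENNReal.ofReal 2 by simp,
    ← ENNReal.ofReal_mul two_pos.le]
  congr 1
  have hzz : z ^ (1 + 2 * s) * z ^ (-(2 * s)) = z := by
    rw [← Real.rpow_add hz0, add_neg_cancel_right, Real.rpow_one]
  calc 2 * (2 * d * z ^ (1 + 2 * s) * Real.exp E *
        (C₀ * 6 ^ s * 8 ^ s * (L * r) ^ (-(d : ℝ)) * z ^ (-(2 * s))))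
      = 2 * (2 * d * Real.exp E * (C₀ * 6 ^ s * 8 ^ s)) * (L * r) ^ (-(d : ℝ)) *
          (z ^ (1 + 2 * s) * z ^ (-(2 * s))) := by ring
    _ = _ := by rw [hzz]

/-- Off-diagonal bound. Before the time scale of `x` the walk gets to `x` by a single long step, or
else by short steps only. -/
theorem exists_walk_le_div_growth (hd : 0 < d) (hα : 0 < α) (hKlb : 0 < Klb) (hKub : 0 < Kub)
    (hΔ : Δ ∈ Set.Ioo (0 : ℝ) 1) :
    ∃ C : ℝ, 0 < C ∧ ∀ L : ℝ, 1 ≤ L → ∀ P : (Fin d → ℤ) → ℝ,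
      IsPowerLawKernel α L Klb Kub Δ P → ∀ n : ℕ, 1 ≤ n → ∀ x : Fin d → ℤ,
      walk (fun y => ENNReal.ofReal (P y)) n x ≤ ENNReal.ofReal
        (C * (L * scaledNorm L x) ^ (-(d : ℝ)) * (n / growth α (scaledNorm L x))) := by
  obtain ⟨C₀, hC₀, hon⟩ := exists_walk_le hd hα hKlb hKub hΔ
  have hd0 : (0 : ℝ) < d := by exact_mod_cast hd
  have ha : 0 < min α 2 := lt_min hα two_pos
  set s := (d : ℝ) / min α 2 with hs
  have hs0 : 0 < s := by positivity
  set η := (Real.pi / 2 * d)⁻¹ with hη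
  have hη0 : 0 < η := by positivity
  obtain ⟨ε, C₁, hε0, hε1, hC₁, hshort⟩ := exists_walk_shortSteps_le hd hα hKlb hKub hΔ hη0
  set g₀ := growth α (Real.pi / 2) with hg₀
  have hg₀1 : 1 ≤ g₀ := one_le_growth hα le_rfl
  set C₂ := 3 * Kub * (ε * η) ^ (-((d : ℝ) + α)) with hC₂
  have hC₂0 : 0 < C₂ := by positivity
  set C₃ := C₀ * 8 ^ s * g₀ ^ (2 * s + 1) with hC₃
  have hC₃0 : 0 < C₃ := by positivity
  refine ⟨C₀ + C₁ + C₂ + C₃, by positivity, fun L hL P hP n hn x => ?_⟩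
  have hL0 : 0 < L := by linarith
  set r := scaledNorm L x with hrdef
  have hr : Real.pi / 2 ≤ r := pi_div_two_le_scaledNorm L x
  have hr1 := one_le_of_pi_div_two_le hr
  have hr0 : 0 < r := by linarith
  have hg := one_le_growth hα hr
  set g := growth α r with hgdef
  have hg0 : 0 < g := by linarith
  have hn1 : (1 : ℝ) ≤ n := by exact_mod_cast hn
  have hlog := timeLog_pos α hn1
  set D := (L * r) ^ (-(d : ℝ)) with hD
  have hD0 : 0 < D := by positivity
  have hDeq : D = L ^ (-(d : ℝ)) * r ^ (-(d : ℝ)) := Real.mul_rpow hL0.le hr0.le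
  have hz0 : 0 < (n : ℝ) / g := by positivity
  rcases le_or_gt g n with hgn | hng
  · refine (hon L hL P hP n hn x).trans (ENNReal.ofReal_le_ofReal ?_)
    have h1 : 1 ≤ (n : ℝ) / g := (one_le_div hg0).2 hgn
    calc C₀ * L ^ (-(d : ℝ)) * ((n : ℝ) * timeLog α n) ^ (-s)
        ≤ C₀ * L ^ (-(d : ℝ)) * r ^ (-(d : ℝ)) := by
          gcongr
          exact rpow_time_le d hα hr hgn
      _ = C₀ * D * 1 := by rw [hDeq]; ring
      _ ≤ (C₀ + C₁ + C₂ + C₃) * D * (n / g) := by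
          gcongr
          linarith
  rcases lt_or_ge ‖toEuclid x‖ L with hxL | hxL
  · -- at distances below the range, the time scale is of order one
    have hrL : r = Real.pi / 2 := by
      have : L⁻¹ * ‖toEuclid x‖ ≤ 1 := by
        rw [← div_eq_inv_mul]
        exact (div_le_one hL0).2 hxL.le
      rw [hrdef, scaledNorm, tnorm, norm_smul, norm_inv, Real.norm_eq_abs, abs_of_pos hL0,
        max_eq_right this, mul_one]
    have hgg : g = g₀ := by rw [hgdef, hrL]
    refine (hon L hL P hP n hn x).trans (ENNReal.ofReal_le_ofReal ?_)
    have hz : ((n : ℝ) / g) ^ (-(2 * s)) ≤ g₀ ^ (2 * s + 1) * (n / g) := by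
      have h1 : ((n : ℝ) / g) ^ (-(2 * s)) = ((n : ℝ) / g) ^ (-(2 * s + 1)) * (n / g) := by
        rw [← Real.rpow_add_one hz0.ne']
        congr 1
        ring
      have h2 : ((n : ℝ) / g) ^ (-(2 * s + 1)) ≤ (1 / g) ^ (-(2 * s + 1)) :=
        Real.rpow_le_rpow_of_nonpos (by positivity) (by gcongr) (by linarith)
      rw [h1]
      gcongr
      refine h2.trans (le_of_eq ?_)
      rw [one_div, Real.inv_rpow hg0.le, Real.rpow_neg hg0.le, inv_inv, hgg]
    calc C₀ * L ^ (-(d : ℝ)) * ((n : ℝ) * timeLog α n) ^ (-s)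
        ≤ C₀ * L ^ (-(d : ℝ)) * (8 ^ s * (n / g) ^ (-(2 * s)) * r ^ (-(d : ℝ))) := by
          gcongr
          exact rpow_time_le' d hα hr hn1 hng.le
      _ ≤ C₀ * L ^ (-(d : ℝ)) * (8 ^ s * (g₀ ^ (2 * s + 1) * (n / g)) * r ^ (-(d : ℝ))) := by
          gcongr
      _ = C₃ * D * (n / g) := by rw [hDeq, hC₃]; ring
      _ ≤ (C₀ + C₁ + C₂ + C₃) * D * (n / g) := by
          gcongr
          linarith
  -- from here on `‖x‖` is comparable to `L * r`
  have hLr : L * r = tnorm L (toEuclid x) := (tnorm_eq_mul_scaledNorm hL0 x).symm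
  have hLr' : L * r = Real.pi / 2 * ‖toEuclid x‖ := by rw [hLr, tnorm, max_eq_left hxL]
  have hηx : η * (L * r) ≤ ‖x‖ := by
    rw [hη, inv_mul_le_iff₀ (by positivity), hLr', mul_assoc]
    gcongr
    exact norm_toEuclid_le x
  have hxr : ‖x‖ ≤ L * r := by
    rw [hLr]
    exact (le_max_left _ _).trans (max_le_tnorm x)
  have hlong : ∀ y : Fin d → ℤ, ε * ‖x‖ ≤ ‖y‖ → P y ≤ C₂ * (D / g) := fun y hy =>
    hP.le_of_mul_le_norm hα hL hKub (by positivity) hr (by nlinarith)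
  rcases Nat.lt_or_ge 1 n with hn2 | hn2
  · set M := ⌊ε * ‖x‖⌋₊ with hM
    set b : (Fin d → ℤ) → ℝ≥0∞ := ((box d M : Set (Fin d → ℤ))ᶜ).indicator
      fun y => ENNReal.ofReal (P y) with hb
    have hsplit : (fun y => ENNReal.ofReal (P y)) = fun y => shortSteps P M y + b y := by
      funext y
      exact (congrFun (Set.indicator_self_add_compl (box d M : Set (Fin d → ℤ))
        fun y => ENNReal.ofReal (P y)) y).symm
    have hbβ : ∀ y, b y ≤ ENNReal.ofReal (C₂ * (D / g)) := by
      intro y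
      by_cases hy : y ∈ box d M
      · rw [hb, Set.indicator_of_notMem (by simpa using hy)]
        exact bot_le
      · rw [hb, Set.indicator_of_mem (by simpa using hy)]
        refine ENNReal.ofReal_le_ofReal (hlong y ?_)
        rw [mem_box] at hy
        push Not at hy
        obtain ⟨i, hi⟩ := hy
        have h1 : ((M : ℝ) + 1) ≤ ‖y i‖ := by
          rw [Int.norm_eq_abs]
          exact_mod_cast hi
        exact (Nat.lt_floor_add_one _).le.trans (h1.trans (norm_le_pi_norm y i))
    have hsum : ∑' y, (shortSteps P M y + b y) ≤ 1 := by
      rw [← hsplit, ← ENNReal.ofReal_tsum_of_nonneg hP.nonneg hP.hasSum_one.summable,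
        hP.hasSum_one.tsum_eq, ENNReal.ofReal_one]
    rw [hsplit]
    refine (walk_add_le hbβ hsum n x).trans ?_
    refine (add_le_add_left (hshort L hL P hP n hn2 x r hr hng hηx hxr) _).trans ?_
    rw [← ENNReal.ofReal_natCast, ← ENNReal.ofReal_mul (by positivity),
      ← ENNReal.ofReal_add (by positivity) (by positivity)]
    refine ENNReal.ofReal_le_ofReal ?_
    calc C₁ * D * (n / g) + n * (C₂ * (D / g)) = (C₁ + C₂) * D * (n / g) := by ring
      _ ≤ (C₀ + C₁ + C₂ + C₃) * D * (n / g) :=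
          mul_le_mul_of_nonneg_right (mul_le_mul_of_nonneg_right (by linarith) hD0.le) hz0.le
  · obtain rfl : n = 1 := by omega
    rw [walk_one]
    refine ENNReal.ofReal_le_ofReal ((hlong x ?_).trans ?_)
    · exact mul_le_of_le_one_left (norm_nonneg x) hε1
    · calc C₂ * (D / g) = C₂ * D * ((1 : ℕ) / g) := by push_cast; ring
        _ ≤ _ := by
          gcongr
          linarith

end IsPowerLawKernel

end OffDiagonal

/-! ### Summation over the number of steps -/

section Sum

variable {d : ℕ} {α L Klb Kub Δ : ℝ} {P : (Fin d → ℤ) → ℝ}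

theorem twoPoint_le_delta_add (hP : ∀ x, 0 ≤ P x) {μ : ℝ} (hμ : 0 ≤ μ) (x : Fin d → ℤ) :
    twoPoint P μ x ≤ delta x + ∑' n : ℕ,
      ENNReal.ofReal μ ^ (n + 1) * walk (fun y => ENNReal.ofReal (P y)) (n + 1) x := by
  rw [twoPoint_eq P hP hμ, tsum_eq_zero_add' ENNReal.summable, pow_zero, one_mul]
  refine add_le_add_left (le_of_eq ?_) _
  by_cases hx : x = 0
  · simp [hx, delta, walk_zero_zero]
  · simp [hx, delta, walk_zero_of_ne]

/-- A geometric series with linear weights. -/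
theorem sum_range_mul_pow_le {μ : ℝ} (hμ0 : 0 ≤ μ) (hμ1 : μ < 1) (N : ℕ) :
    ∑ n ∈ Finset.range N, μ ^ (n + 1) * ((n : ℝ) + 1) ≤ 1 / (1 - μ) ^ 2 := by
  have h := hasSum_coe_mul_geometric_of_norm_lt_one (r := μ)
    (by rwa [Real.norm_eq_abs, abs_of_nonneg hμ0])
  have h2 := sum_le_hasSum (Finset.range (N + 1)) (fun n _ => by positivity) h
  rw [Finset.sum_range_succ'] at h2
  have h3 : μ / (1 - μ) ^ 2 ≤ 1 / (1 - μ) ^ 2 := by gcongr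
  refine le_trans (le_of_eq ?_) (h2.trans h3)
  simp only [Nat.cast_zero, zero_mul, add_zero]
  refine Finset.sum_congr rfl fun n _ => ?_
  push_cast
  ring

namespace IsPowerLawKernel

/-- The two-point function away from its zero-step term, in terms of the time scale of `x`: the
off-diagonal bound is summed up to that time, the uniform bound beyond it, and with a killing rate
`1 - μ` the off-diagonal bound is summed over all times. -/
theorem exists_sum_walk_le (hα : 0 < α) (hdα : min α 2 < (d : ℝ)) (hKlb : 0 < Klb)
    (hKub : 0 < Kub) (hΔ : Δ ∈ Set.Ioo (0 : ℝ) 1) :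
    ∃ C : ℝ, 0 < C ∧ ∀ L : ℝ, 1 ≤ L → ∀ P : (Fin d → ℤ) → ℝ,
      IsPowerLawKernel α L Klb Kub Δ P → ∀ μ : ℝ, μ ∈ Set.Icc (0 : ℝ) 1 → ∀ x : Fin d → ℤ,
      twoPoint P μ x ≤ delta x + ENNReal.ofReal
        (C * (L * scaledNorm L x) ^ (-(d : ℝ)) * growth α (scaledNorm L x)) *
        min 1 (1 / ENNReal.ofReal (growth α (scaledNorm L x) ^ 2 * (1 - μ) ^ 2)) := by
  have ha : 0 < min α 2 := lt_min hα two_pos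
  have hd0 : (0 : ℝ) < d := ha.trans hdα
  have hd : 0 < d := by exact_mod_cast hd0
  obtain ⟨C₀, hC₀, hon⟩ := exists_walk_le hd hα hKlb hKub hΔ
  obtain ⟨C₁, hC₁, hoff⟩ := exists_walk_le_div_growth hd hα hKlb hKub hΔ
  set s := (d : ℝ) / min α 2 with hs
  have hs1 : 1 < s := (one_lt_div ha).2 hdα
  obtain ⟨C₂, hC₂, htail⟩ := exists_sum_tail_le hs1
  refine ⟨C₁ + C₀ * C₂, by positivity, fun L hL P hP μ hμ x => ?_⟩
  obtain ⟨hμ0, hμ1⟩ := hμ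
  have hL0 : 0 < L := by linarith
  set r := scaledNorm L x with hrdef
  have hr : Real.pi / 2 ≤ r := pi_div_two_le_scaledNorm L x
  have hr0 : 0 < r := by linarith [one_le_of_pi_div_two_le hr]
  have hg := one_le_growth hα hr
  have hl := spaceLog_pos (α := α) hr
  set g := growth α r with hgdef
  have hg0 : 0 < g := by linarith
  set D := (L * r) ^ (-(d : ℝ)) with hD
  have hD0 : 0 < D := by positivity
  have hDeq : D = L ^ (-(d : ℝ)) * r ^ (-(d : ℝ)) := Real.mul_rpow hL0.le hr0.le
  refine (twoPoint_le_delta_add hP.nonneg hμ0 x).trans (add_le_add_right ?_ _)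
  set w := walk fun y => ENNReal.ofReal (P y) with hw
  -- summation up to the time scale and beyond
  have hfull : ∑' n : ℕ, ENNReal.ofReal μ ^ (n + 1) * w (n + 1) x ≤
      ENNReal.ofReal ((C₁ + C₀ * C₂) * D * g) := by
    have hterm : ∀ n : ℕ, ENNReal.ofReal μ ^ (n + 1) * w (n + 1) x ≤ ENNReal.ofReal
        (C₁ * D * (if (n : ℝ) + 1 ≤ g then 1 else 0) + C₀ * L ^ (-(d : ℝ)) *
          spaceLog α r ^ (-s) * (if g ≤ (n : ℝ) + 1 then ((n : ℝ) + 1) ^ (-s) else 0)) := by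
      intro n
      have hn0 : (0 : ℝ) ≤ n := Nat.cast_nonneg n
      have hμn : ENNReal.ofReal μ ^ (n + 1) ≤ 1 :=
        pow_le_one' (ENNReal.ofReal_le_one.2 hμ1) _
      refine (mul_le_of_le_one_left' hμn).trans ?_
      rcases le_or_gt g ((n : ℝ) + 1) with h | h
      · refine (hon L hL P hP (n + 1) (by omega) x).trans (ENNReal.ofReal_le_ofReal ?_)
        rw [if_pos h]
        push_cast
        have hlog := timeLog_pos α (by linarith : 1 ≤ (n : ℝ) + 1)
        have h1 : (((n : ℝ) + 1) * timeLog α ((n : ℝ) + 1)) ^ (-s) ≤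
            spaceLog α r ^ (-s) * ((n : ℝ) + 1) ^ (-s) := by
          rw [← Real.mul_rpow hl.le (by positivity), mul_comm]
          refine Real.rpow_le_rpow_of_nonpos (by positivity) ?_ (by linarith)
          gcongr
          exact spaceLog_le_timeLog hr h
        have h2 : 0 ≤ C₁ * D * (if (n : ℝ) + 1 ≤ g then 1 else 0) := by
          split_ifs <;> positivity
        have h3 := mul_le_mul_of_nonneg_left h1
          (by positivity : 0 ≤ C₀ * L ^ (-(d : ℝ)))
        linarith
      · refine (hoff L hL P hP (n + 1) (by omega) x).trans (ENNReal.ofReal_le_ofReal ?_)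
        rw [if_pos h.le, if_neg (not_le.2 h), mul_one, mul_zero, add_zero]
        refine mul_le_of_le_one_right (by positivity) ?_
        rw [div_le_one hg0]
        push_cast
        exact h.le
    rw [ENNReal.tsum_eq_iSup_nat]
    refine iSup_le fun N => ?_
    refine (Finset.sum_le_sum fun n _ => hterm n).trans ?_
    rw [← ENNReal.ofReal_sum_of_nonneg fun n _ => by split_ifs <;> positivity]
    refine ENNReal.ofReal_le_ofReal ?_
    rw [Finset.sum_add_distrib, ← Finset.mul_sum, ← Finset.mul_sum]
    have hcount : ∑ n ∈ Finset.range N, (if (n : ℝ) + 1 ≤ g then (1 : ℝ) else 0) ≤ g := by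
      rw [← Finset.sum_filter, Finset.sum_const, nsmul_eq_mul, mul_one]
      have hsub : (Finset.range N).filter (fun n : ℕ => (n : ℝ) + 1 ≤ g) ⊆
          Finset.range ⌊g⌋₊ := by
        intro n hn
        rw [Finset.mem_filter] at hn
        rw [Finset.mem_range]
        exact Nat.le_floor (by push_cast; exact hn.2)
      have := Finset.card_le_card hsub
      rw [Finset.card_range] at this
      exact (by exact_mod_cast this : _ ≤ ((⌊g⌋₊ : ℕ) : ℝ)).trans (Nat.floor_le hg0.le)
    have hlate : spaceLog α r ^ (-s) * g ^ (1 - s) = r ^ (-(d : ℝ)) * g := by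
      rw [← rpow_min_rpow_neg d hα hr0, ← growth_mul_spaceLog hr,
        Real.mul_rpow hg0.le hl.le, sub_eq_add_neg, Real.rpow_add hg0, Real.rpow_one]
      ring
    calc C₁ * D * ∑ n ∈ Finset.range N, (if (n : ℝ) + 1 ≤ g then (1 : ℝ) else 0) +
          C₀ * L ^ (-(d : ℝ)) * spaceLog α r ^ (-s) *
            ∑ n ∈ Finset.range N, (if g ≤ (n : ℝ) + 1 then ((n : ℝ) + 1) ^ (-s) else 0)
        ≤ C₁ * D * g + C₀ * L ^ (-(d : ℝ)) * spaceLog α r ^ (-s) * (C₂ * g ^ (1 - s)) := by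
          gcongr
          exact htail g hg N
      _ = C₁ * D * g + C₀ * L ^ (-(d : ℝ)) * C₂ * (spaceLog α r ^ (-s) * g ^ (1 - s)) := by
          ring
      _ = (C₁ + C₀ * C₂) * D * g := by rw [hlate, hDeq]; ring
  rcases eq_or_lt_of_le hμ1 with rfl | hμ1
  · simpa using hfull
  -- with a killing rate, the off-diagonal bound is summable by itself
  have hmass : ∑' n : ℕ, ENNReal.ofReal μ ^ (n + 1) * w (n + 1) x ≤
      ENNReal.ofReal (C₁ * D * g * (1 / (g ^ 2 * (1 - μ) ^ 2))) := by
    rw [ENNReal.tsum_eq_iSup_nat]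
    refine iSup_le fun N => ?_
    have hterm : ∀ n : ℕ, ENNReal.ofReal μ ^ (n + 1) * w (n + 1) x ≤
        ENNReal.ofReal (C₁ * D / g * (μ ^ (n + 1) * ((n : ℝ) + 1))) := by
      intro n
      refine (mul_le_mul_right (hoff L hL P hP (n + 1) (by omega) x) _).trans (le_of_eq ?_)
      rw [← ENNReal.ofReal_pow hμ0, ← ENNReal.ofReal_mul (by positivity)]
      push_cast
      congr 1
      ring
    refine (Finset.sum_le_sum fun n _ => hterm n).trans ?_
    rw [← ENNReal.ofReal_sum_of_nonneg fun n _ => by positivity, ← Finset.mul_sum]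
    refine ENNReal.ofReal_le_ofReal ?_
    refine (mul_le_mul_of_nonneg_left (sum_range_mul_pow_le hμ0 hμ1 N)
      (by positivity)).trans (le_of_eq ?_)
    have : 0 < 1 - μ := by linarith
    field_simp
  have hμ' : 0 < 1 - μ := by linarith
  have hmin : min 1 (1 / ENNReal.ofReal (g ^ 2 * (1 - μ) ^ 2)) =
      ENNReal.ofReal (min 1 (1 / (g ^ 2 * (1 - μ) ^ 2))) := by
    rw [ENNReal.ofReal_min, ENNReal.ofReal_one, ENNReal.ofReal_div_of_pos (by positivity),
      ENNReal.ofReal_one]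
  rw [hmin, ← ENNReal.ofReal_mul (by positivity), mul_min_of_nonneg _ _ (by positivity), mul_one,
    ENNReal.ofReal_min]
  refine le_min hfull (hmass.trans (ENNReal.ofReal_le_ofReal ?_))
  have : 0 ≤ C₀ * C₂ := by positivity
  gcongr
  linarith

end IsPowerLawKernel

end Sum

end LongRange

end

/-- The bounds are inequalities in `[0, ∞]`, so they contain the convergence of the sum that
defines the two-point function, and `1 / 0 = ∞` there: at `μ = 1` the minimum equals `1`. -/
theorem mainTheorem3 (d : ℕ) (α : ℝ) (hα : 0 < α) (hd : min α 2 < (d : ℝ))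
    (Klb Kub Δ : ℝ) (hKlb : 0 < Klb) (hKub : 1 ≤ Kub) (hΔ : Δ ∈ Set.Ioo (0 : ℝ) 1) :
    ∃ KC : ℝ, 0 < KC ∧ ∀ L : ℝ, 1 ≤ L → ∀ P : (Fin d → ℤ) → ℝ,
      LongRange.IsPowerLawKernel α L (Klb / 2) (2 * Kub) (Δ / 2) P →
      ∀ μ : ℝ, μ ∈ Set.Icc (0 : ℝ) 1 → ∀ x : Fin d → ℤ,
        (α ≠ 2 →
          LongRange.twoPoint P μ x ≤ LongRange.delta x +
            ENNReal.ofReal (KC / (L ^ (min α 2) *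
              LongRange.tnorm L (LongRange.toEuclid x) ^ ((d : ℝ) - min α 2))) *
            min 1 (1 / ENNReal.ofReal
              (LongRange.tnorm 1 (L⁻¹ • LongRange.toEuclid x) ^ (2 * min α 2) *
                (1 - μ) ^ 2))) ∧
        (α = 2 →
          LongRange.twoPoint P μ x ≤ LongRange.delta x +
            ENNReal.ofReal (KC / (L ^ 2 *
              LongRange.tnorm L (LongRange.toEuclid x) ^ ((d : ℝ) - 2) *
              Real.log (LongRange.tnorm 1 (L⁻¹ • LongRange.toEuclid x)))) *
            min 1 (ENNReal.ofReal
                (Real.log (LongRange.tnorm 1 (L⁻¹ • LongRange.toEuclid x)) ^ 2) /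
              ENNReal.ofReal
                (LongRange.tnorm 1 (L⁻¹ • LongRange.toEuclid x) ^ 4 * (1 - μ) ^ 2))) := by
  obtain ⟨hΔ0, hΔ1⟩ := hΔ
  obtain ⟨C, hC, h⟩ := LongRange.IsPowerLawKernel.exists_sum_walk_le (d := d) (Klb := Klb / 2)
    (Kub := 2 * Kub) (Δ := Δ / 2) hα hd (by linarith) (by linarith) ⟨by linarith, by linarith⟩
  refine ⟨C, hC, fun L hL P hP μ hμ x => ?_⟩
  have hmain := h L hL P hP μ hμ x
  have hL0 : 0 < L := by linarith
  have hr : Real.pi / 2 ≤ LongRange.scaledNorm L x := LongRange.pi_div_two_le_scaledNorm L x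
  have hr0 : 0 < LongRange.scaledNorm L x := by
    linarith [LongRange.one_le_of_pi_div_two_le hr]
  have hlog : 0 < Real.log (LongRange.scaledNorm L x) := by linarith [LongRange.third_le_log hr]
  rw [LongRange.tnorm_eq_mul_scaledNorm hL0 x,
    show LongRange.tnorm 1 (L⁻¹ • LongRange.toEuclid x) = LongRange.scaledNorm L x from rfl]
  set r := LongRange.scaledNorm L x
  refine ⟨fun hα2 => ?_, fun hα2 => ?_⟩
  · have hg : LongRange.growth α r = r ^ (min α 2) := by
      rw [LongRange.growth, LongRange.spaceLog, if_neg hα2, div_one]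
    have e1 : C * (L * r) ^ (-(d : ℝ)) * LongRange.growth α r =
        C / (L ^ (min α 2) * (L * r) ^ ((d : ℝ) - min α 2)) := by
      rw [hg, Real.rpow_sub (by positivity), Real.mul_rpow (z := min α 2) hL0.le hr0.le,
        Real.rpow_neg (by positivity)]
      field_simp
    have e2 : LongRange.growth α r ^ 2 = r ^ (2 * min α 2) := by
      rw [hg, ← Real.rpow_natCast, ← Real.rpow_mul hr0.le]
      congr 1
      push_cast
      ring
    rwa [e1, e2] at hmain
  · have hg : LongRange.growth α r = r ^ 2 / Real.log r := by
      rw [LongRange.growth, LongRange.spaceLog, if_pos hα2, hα2, min_self, Real.rpow_two]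
    have e1 : C * (L * r) ^ (-(d : ℝ)) * LongRange.growth α r =
        C / (L ^ 2 * (L * r) ^ ((d : ℝ) - 2) * Real.log r) := by
      rw [hg, Real.rpow_sub (by positivity), Real.rpow_two, Real.rpow_neg (by positivity)]
      field_simp
    have e2 : 1 / ENNReal.ofReal (LongRange.growth α r ^ 2 * (1 - μ) ^ 2) =
        ENNReal.ofReal (Real.log r ^ 2) / ENNReal.ofReal (r ^ 4 * (1 - μ) ^ 2) := by
      have e3 : LongRange.growth α r ^ 2 * (1 - μ) ^ 2 =
          r ^ 4 * (1 - μ) ^ 2 / Real.log r ^ 2 := by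
        rw [hg]
        field_simp
      have hpos : ENNReal.ofReal (Real.log r ^ 2) ≠ 0 := by
        rw [Ne, ENNReal.ofReal_eq_zero, not_le]
        positivity
      rw [e3, ENNReal.ofReal_div_of_pos (by positivity), one_div,
        ENNReal.inv_div (Or.inl ENNReal.ofReal_ne_top) (Or.inl hpos)]
    rwa [e1, e2] at hmain
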